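/- Call a system of vectors $\{u_n\}$ in a complex Hilbert space $H$ a (QF)-system if (i) for every real $q>2$ there is a constant $C(q)$ such that for every $f\in H$ and $\epsilon>0$ there is a finite linear combination $Q=\sum c_nu_n$ with $\|f-Q\|<\epsilon$ and $\left(\sum|c_n|^q\right)^{1/q}\le C(q)\|f\|$; and (ii) there is a constant $C'$ such that $\left(\sum_n|\langle f,u_n\rangle|^2\right)^{1/2}\le C'\|f\|$ for all $f\in H$. Call a sequence $\{\lambda_n\}$ of real numbers uniformly discrete if $\inf_{m\ne n}|\lambda_m-\lambda_n|>0$. **Proposition 1.** (1) There exist a uniformly discrete sequence $\{\lambda_n\}$ of real numbers and a function $g\in L^2(\mathbb{R})$ (complex-valued) such that $\{g(t-\lambda_n)\}$ is a (QF)-system in $L^2(\mathbb{R})$ and $g$ is infinitely differentiable; $g$ can even be chosen to be the restriction to $\mathbb{R}$ of an entire function. (2) For every sequence of positive numbers $\epsilon_n\to 0$, the sequence $\{\lambda_n\}$ and the function $g$ in (1), with $g$ the restriction to $\mathbb{R}$ of an entire function (in particular infinitely differentiable), can be chosen so that in addition $\lambda_n>0$ and $\lambda_{n+1}/\lambda_n>1+\epsilon_n$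 for all $n$. -/

import Mathlib

open MeasureTheory Filter Topology
open scoped ContDiff

/-- A sequence of real numbers is uniformly discrete if distinct terms are separated by a
fixed positive distance. -/
def UniformlyDiscrete (lam : ℕ → ℝ) : Prop :=
  ∃ δ : ℝ, 0 < δ ∧ ∀ m n : ℕ, m ≠ n → δ ≤ |lam m - lam n|

/-- A system of vectors `u n` in a complex Hilbert space is a (QF)-system if it is complete with
an `ℓ_q` estimate of the coefficients for every `q > 2` (finite linear combinations, with a
constant depending on `q` only), and it satisfies the Bessel inequality. -/
structure IsQFSystem {H : Type*} [NormedAddCommGroup H] [InnerProductSpace ℂ H]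
    {ι : Type*} (u : ι → H) : Prop where
  approx : ∀ q : ℝ, 2 < q → ∃ C : ℝ, ∀ (f : H) (η : ℝ), 0 < η → ∃ c : ι →₀ ℂ,
    ‖f - ∑ n ∈ c.support, c n • u n‖ < η ∧
    (∑ n ∈ c.support, ‖c n‖ ^ q) ^ (1 / q) ≤ C * ‖f‖
  bessel : ∃ C' : ℝ, ∀ f : H,
    Summable (fun n => ‖inner ℂ f (u n)‖ ^ 2) ∧
    Real.sqrt (∑' n, ‖inner ℂ f (u n)‖ ^ 2) ≤ C' * ‖f‖

/-- The translate `t ↦ g (t - a)` of a square integrable function `g`, as an element of the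
Hilbert space `L²(ℝ)`. -/
noncomputable def translateLp (g : ℝ → ℂ) (hg : MemLp g 2 volume) (a : ℝ) :
    Lp ℂ 2 (volume : Measure ℝ) :=
  MemLp.toLp (fun t : ℝ => g (t - a))
    (hg.comp_measurePreserving (measurePreserving_sub_right volume a))

/-! Under the Fourier transform, translates of `g` become weighted exponentials `w(x) e(λₙ x)`,
where `g` is the transform of `w`. If `0 ≤ w ≤ exp(-πx²/2)`, then `g` is entire, and the Bessel
inequality for separated `λₙ` follows from Schur's test on a Gaussian Gram matrix
(`exists_entire_translates`, `bessel_weightedExp`). Only approximation with small coefficients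
remains.

The core is `exists_small_coeff_approx_one`: for `q > 2`, some polynomial without constant term has
small `ℓ^q` coefficients and is close to `1` in measure on the circle. A Riesz product `∏ (1 + r cos
2πMₗx)` with `K ≈ A/r²` factors has constant term `1`. It is small in measure for large `A`, its
`ℓ²` norm is bounded in terms of `A`, and the `ℓ^q` norm of its other coefficients tends to `0` with
`r`, since `K r^q ≈ A r^(q-2)`. So `1` minus the product works, except for its negative frequencies;
these are made positive by multiplying that part by `T(e(Lx))`, with `T(0) = 0` and `T ≈ 1` in
measure.

Such a polynomial, dilated by `R` and modulated by a rational frequency `k`, approximates `e(kx)`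
using frequencies `k + R, ..., k + RD`. Dilation does not affect the measure estimate, so `R` can be
chosen after `D`. This lets the blocks be concatenated quasi-lacunarily: a block of length `D` has
ratios about `1 + 1/D`, which is enough once `εₙ` is small (`exists_lacunary_blocks`). Fast
convergence in measure becomes convergence in `L²` through one weight `w` (`exists_weight`). Each
rational frequency recurs in infinitely many blocks, so any finite combination of rational
exponentials can be replaced by blocks of negligible `ℓ^q` norm (`isQFSystem_weightedExp`). -/

/-! ### Exponentials on the line. -/

/-- The exponential `x ↦ exp (2 π i a x)` of real frequency `a`. -/
noncomputable def expFreq (a x : ℝ) : ℂ := Complex.exp ((2 * Real.pi * (a * x) : ℝ) * Complex.I)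

@[simp] lemma norm_expFreq (a x : ℝ) : ‖expFreq a x‖ = 1 := Complex.norm_exp_ofReal_mul_I _

@[fun_prop] lemma continuous_expFreq (a : ℝ) : Continuous (expFreq a) := by
  unfold expFreq; fun_prop

lemma expFreq_add (a b x : ℝ) : expFreq (a + b) x = expFreq a x * expFreq b x := by
  unfold expFreq
  rw [← Complex.exp_add]; congr 1; push_cast; ring

@[simp] lemma expFreq_zero (x : ℝ) : expFreq 0 x = 1 := by simp [expFreq]

@[simp] lemma expFreq_zero_right (a : ℝ) : expFreq a 0 = 1 := by simp [expFreq]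

lemma conj_expFreq (a x : ℝ) : (starRingEnd ℂ) (expFreq a x) = expFreq (-a) x := by
  unfold expFreq
  rw [← Complex.exp_conj, map_mul, Complex.conj_ofReal, Complex.conj_I]; congr 1; push_cast; ring

lemma expFreq_mul (a b x : ℝ) : expFreq (a * b) x = expFreq a (b * x) := by
  unfold expFreq; congr 3; ring

lemma expFreq_pow (a x : ℝ) (n : ℕ) : expFreq a x ^ n = expFreq (n * a) x := by
  unfold expFreq
  rw [← Complex.exp_nat_mul]; congr 1; push_cast; ring

lemma expFreq_add_right (a x y : ℝ) : expFreq a (x + y) = expFreq a x * expFreq a y := by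
  unfold expFreq
  rw [← Complex.exp_add]; congr 1; push_cast; ring

@[simp] lemma expFreq_intCast_one (n : ℤ) : expFreq n 1 = 1 := by
  unfold expFreq
  rw [Complex.exp_eq_one_iff]; exact ⟨n, by push_cast; ring⟩

lemma expFreq_periodic (n : ℤ) : Function.Periodic (expFreq n) 1 := fun x => by
  rw [expFreq_add_right, expFreq_intCast_one, mul_one]

lemma integral_expFreq_intCast {n : ℤ} (hn : n ≠ 0) : ∫ x in (0 : ℝ)..1, expFreq n x = 0 := by
  have h : (2 * Real.pi * n * Complex.I : ℂ) ≠ 0 := by simp [hn, Real.pi_ne_zero]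
  have := integral_exp_mul_complex (a := 0) (b := 1) h
  have e : ∀ x : ℝ, expFreq n x = Complex.exp (2 * Real.pi * n * Complex.I * x) := fun x => by
    unfold expFreq; congr 1; push_cast; ring
  simp_rw [e, this]
  rw [← e, ← e]; simp

lemma expFreq_one_ne_one {x : ℝ} (h0 : 0 < x) (h1 : x < 1) : expFreq 1 x ≠ 1 := by
  unfold expFreq
  intro h
  rw [Complex.exp_eq_one_iff] at h
  obtain ⟨n, hn⟩ := h
  have h2 : (x : ℂ) = n := by
    have h3 : (2 * Real.pi * Complex.I : ℂ) ≠ 0 := by simp [Real.pi_ne_zero]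
    apply mul_left_cancel₀ h3
    push_cast at hn
    linear_combination hn
  have h3 : x = n := by exact_mod_cast h2
  rw [h3] at h0 h1
  have : (0 : ℤ) < n := by exact_mod_cast h0
  have : n < (1 : ℤ) := by exact_mod_cast h1
  omega

/-! ### Polynomials vanishing at zero and close to one in measure. -/

open Polynomial in
/-- Cesàro means of the partial sums of `∑ z ^ m`, `m ≥ 1`. -/
noncomputable def cesaroGeom (n : ℕ) : ℂ[X] :=
  C (1 / (n : ℂ)) * ∑ i ∈ Finset.range n, ∑ m ∈ Finset.range i, X ^ (m + 1)

lemma cesaroGeom_coeff_zero (n : ℕ) : (cesaroGeom n).coeff 0 = 0 := by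
  simp [cesaroGeom, Polynomial.coeff_zero_eq_eval_zero, Polynomial.eval_finsetSum]

/-- The Cesàro means converge to `z / (1 - z)`, and this map sends the unit circle without `1` into
the line `Re = -1/2`. -/
lemma tendsto_re_cesaroGeom {z : ℂ} (hz : ‖z‖ = 1) (hz1 : z ≠ 1) :
    Tendsto (fun n => ((cesaroGeom n).eval z).re) atTop (𝓝 (-1 / 2)) := by
  have hz' : z - 1 ≠ 0 := sub_ne_zero.2 hz1
  have h0 : Tendsto (fun n : ℕ => 1 / (n : ℂ) * ((z ^ n - 1) / (z - 1))) atTop (𝓝 0) := by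
    rw [tendsto_zero_iff_norm_tendsto_zero]
    have h1 : Tendsto (fun n : ℕ => 1 / (n : ℝ) * (2 / ‖z - 1‖)) atTop (𝓝 0) := by
      simpa using (tendsto_one_div_atTop_nhds_zero_nat (𝕜 := ℝ)).mul_const (2 / ‖z - 1‖)
    refine squeeze_zero (fun _ => norm_nonneg _) (fun n => ?_) h1
    rw [norm_mul, norm_div, norm_div]
    simp only [norm_one, Complex.norm_natCast]
    gcongr
    calc ‖z ^ n - 1‖ ≤ ‖z ^ n‖ + ‖(1 : ℂ)‖ := norm_sub_le _ _
      _ = 2 := by simp [hz]; norm_num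
  have h2 : ∀ᶠ n : ℕ in atTop, z / (z - 1) * (1 / (n : ℂ) * ((z ^ n - 1) / (z - 1)) - 1) =
      (cesaroGeom n).eval z := by
    filter_upwards [eventually_ne_atTop 0] with n hn
    have hn' : (n : ℂ) ≠ 0 := by exact_mod_cast hn
    have e : ∀ i, ∑ m ∈ Finset.range i, z ^ (m + 1) = z / (z - 1) * (z ^ i - 1) := fun i => by
      simp_rw [pow_succ']
      rw [← Finset.mul_sum, geom_sum_eq hz1]; ring
    simp only [cesaroGeom, Polynomial.eval_mul, Polynomial.eval_C, Polynomial.eval_finsetSum,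
      Polynomial.eval_pow, Polynomial.eval_X, e]
    rw [← Finset.mul_sum, Finset.sum_sub_distrib, geom_sum_eq hz1]
    simp
    field_simp
  have h3 := ((h0.sub_const 1).const_mul (z / (z - 1))).congr' h2
  have h4 := (Complex.continuous_re.tendsto _).comp h3
  convert! h4 using 2
  have h5 : z.re * z.re + z.im * z.im = 1 := by
    have := Complex.normSq_eq_norm_sq z
    rw [hz, Complex.normSq_apply] at this; linarith
  have h6 : (1 - z.re) ≠ 0 := by
    intro h
    apply hz1
    have : z.re = 1 := by linarith
    apply Complex.ext
    · simp [this]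
    · simp; nlinarith
  simp only [zero_sub, mul_neg, mul_one, Complex.neg_re, Complex.div_re, Complex.sub_re,
    Complex.one_re, Complex.sub_im, Complex.one_im, sub_zero]
  have h7 : Complex.normSq (z - 1) = 2 * (1 - z.re) := by
    rw [Complex.normSq_apply]; simp; nlinarith
  rw [h7]
  field_simp
  nlinarith

lemma min_one_add_le {a b : ℝ} (ha : 0 ≤ a) (hb : 0 ≤ b) :
    min 1 (a + b) ≤ min 1 a + min 1 b := by
  rcases min_cases 1 (a + b) with h | h <;> rcases min_cases 1 a with h' | h' <;>
    rcases min_cases 1 b with h'' | h'' <;> linarith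

/-- Polynomials vanishing at `0` approximate `1` in measure on the unit circle. -/
lemma exists_polynomial_approx_one (M : ℝ) (hM : 0 ≤ M) {δ : ℝ} (hδ : 0 < δ) :
    ∃ T : Polynomial ℂ, T.coeff 0 = 0 ∧
      ∫ x in (0 : ℝ)..1, min 1 (M * ‖T.eval (expFreq 1 x) - 1‖) < δ := by
  -- The factor `4` makes the integrand equal to `1` on the exceptional set where the real part is
  -- at least `-1/4`, so the integral bounds the measure of that set.
  have lim : Tendsto (fun n => ∫ x in (0 : ℝ)..1,
      min 1 (4 * |((cesaroGeom n).eval (expFreq 1 x)).re + 1 / 2|)) atTop (𝓝 0) := by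
    have := intervalIntegral.tendsto_integral_filter_of_dominated_convergence
      (μ := volume) (a := 0) (b := 1) (l := atTop) (f := fun _ => (0 : ℝ))
      (F := fun n x => min 1 (4 * |((cesaroGeom n).eval (expFreq 1 x)).re + 1 / 2|)) (fun _ => 1)
      (Eventually.of_forall fun n => Continuous.aestronglyMeasurable (by fun_prop))
      (Eventually.of_forall fun n => Eventually.of_forall fun x _ => by
        rw [Real.norm_of_nonneg (by positivity)]; exact min_le_left _ _)
      (by simp) ?_
    · simpa using this
    · have h1 : ∀ᵐ x : ℝ, x ≠ 1 := by simp [ae_iff]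
      filter_upwards [h1] with x hx hx'
      rw [Set.uIoc_of_le zero_le_one] at hx'
      have h2 := tendsto_re_cesaroGeom (norm_expFreq 1 x)
        (expFreq_one_ne_one hx'.1 (lt_of_le_of_ne hx'.2 hx))
      have h3 : Tendsto (fun n => min 1 (4 * |((cesaroGeom n).eval (expFreq 1 x)).re + 1 / 2|))
          atTop (𝓝 (min 1 (4 * |(-1 / 2 : ℝ) + 1 / 2|))) :=
        tendsto_const_nhds.min (((h2.add_const _).abs).const_mul 4)
      norm_num at h3 ⊢
      exact h3
  obtain ⟨n, hn⟩ := ((tendsto_order.1 lim).2 (δ / 2) (by positivity)).exists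
  set h := cesaroGeom n
  obtain ⟨H, hH⟩ : ∃ H : ℝ, ∀ z : ℂ, ‖z‖ = 1 → ‖h.eval z‖ ≤ H := by
    obtain ⟨H, hH⟩ := (isCompact_sphere (0 : ℂ) 1).exists_bound_of_continuousOn
      (f := fun z => h.eval z) h.continuous.continuousOn
    exact ⟨H, fun z hz => hH z (by simpa using hz)⟩
  -- Chosen so that `|1 + c h|² ≤ 1 - c/2 + c² H² ≤ 1 - c/4` wherever `Re h < -1/4`; powers of `1 +
  -- c h` then decay uniformly there.
  set c : ℝ := 1 / (4 * (1 + H ^ 2)) with hc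
  have hc0 : 0 < c := by positivity
  have hcH : c * (1 + H ^ 2) = 1 / 4 := by rw [hc]; field_simp
  have hc1 : c ≤ 1 / 4 := by nlinarith [sq_nonneg H]
  set ρ : ℝ := Real.sqrt (1 - c / 4)
  have hρ0 : 0 ≤ ρ := Real.sqrt_nonneg _
  have hρ1 : ρ < 1 := by
    rw [Real.sqrt_lt' one_pos]; linarith
  have key : ∀ z : ℂ, ‖z‖ = 1 → (h.eval z).re < -1 / 4 → ‖1 + c * h.eval z‖ ≤ ρ := by
    intro z hz hre
    apply Real.le_sqrt_of_sq_le
    have h1 := hH z hz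
    have h2 : ‖h.eval z‖ ^ 2 ≤ H ^ 2 := pow_le_pow_left₀ (norm_nonneg _) h1 2
    rw [← Complex.normSq_eq_norm_sq, Complex.normSq_apply] at h2 ⊢
    simp only [Complex.add_re, Complex.one_re, Complex.mul_re, Complex.ofReal_re,
      Complex.ofReal_im, Complex.add_im, Complex.one_im, Complex.mul_im]
    have h3 : c * c * ((h.eval z).re * (h.eval z).re + (h.eval z).im * (h.eval z).im) ≤
        c * (1 / 4) := by
      rw [mul_assoc]; apply mul_le_mul_of_nonneg_left _ hc0.le
      calc _ ≤ c * H ^ 2 := mul_le_mul_of_nonneg_left h2 hc0.le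
        _ ≤ _ := by nlinarith
    nlinarith
  obtain ⟨k, hk⟩ : ∃ k : ℕ, M * ρ ^ k < δ / 2 := by
    have := (tendsto_pow_atTop_nhds_zero_of_lt_one hρ0 hρ1).const_mul M
    rw [mul_zero] at this
    exact ((tendsto_order.1 this).2 (δ / 2) (by positivity)).exists
  refine ⟨1 - (1 + Polynomial.C (c : ℂ) * h) ^ k, ?_, ?_⟩
  · have h0 : h.eval 0 = 0 := by
      rw [← Polynomial.coeff_zero_eq_eval_zero]; exact cesaroGeom_coeff_zero n
    rw [Polynomial.coeff_zero_eq_eval_zero]; simp [h0]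
  · calc ∫ x in (0 : ℝ)..1, min 1 (M * ‖(1 - (1 + Polynomial.C (c : ℂ) * h) ^ k).eval
            (expFreq 1 x) - 1‖)
        ≤ ∫ x in (0 : ℝ)..1, (min 1 (4 * |(h.eval (expFreq 1 x)).re + 1 / 2|) + M * ρ ^ k) := by
          apply intervalIntegral.integral_mono_on zero_le_one
          · exact Continuous.intervalIntegrable (by fun_prop) _ _
          · exact Continuous.intervalIntegrable (by fun_prop) _ _
          intro x _
          have e : ‖(1 - (1 + Polynomial.C (c : ℂ) * h) ^ k).eval (expFreq 1 x) - 1‖ =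
              ‖1 + c * h.eval (expFreq 1 x)‖ ^ k := by
            rw [← norm_pow, ← norm_neg]; congr 1; simp
          rw [e]
          by_cases hb : (h.eval (expFreq 1 x)).re < -1 / 4
          · refine (min_le_right _ _).trans ?_
            have := pow_le_pow_left₀ (norm_nonneg _) (key _ (norm_expFreq 1 x) hb) k
            have h2 : 0 ≤ min 1 (4 * |(h.eval (expFreq 1 x)).re + 1 / 2|) := by positivity
            nlinarith
          · push Not at hb
            have h2 : min 1 (4 * |(h.eval (expFreq 1 x)).re + 1 / 2|) = 1 := by
              apply min_eq_left
              have := le_abs_self ((h.eval (expFreq 1 x)).re + 1 / 2)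
              linarith
            rw [h2]
            have : 0 ≤ M * ρ ^ k := by positivity
            linarith [min_le_left 1 (M * ‖1 + c * h.eval (expFreq 1 x)‖ ^ k)]
      _ = (∫ x in (0 : ℝ)..1, min 1 (4 * |(h.eval (expFreq 1 x)).re + 1 / 2|)) + M * ρ ^ k := by
          rw [intervalIntegral.integral_add]
          · simp
          · exact Continuous.intervalIntegrable (by fun_prop) _ _
          · simp
      _ < δ := by linarith

/-! ### Riesz products. -/

lemma tendsto_integral_mul_cos {f : ℝ → ℝ} (hf : Continuous f) :
    Tendsto (fun M : ℕ => ∫ x in (0 : ℝ)..1, f x * Real.cos (2 * Real.pi * (M * x))) atTop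
      (𝓝 0) := by
  have h1 := Real.tendsto_integral_exp_smul_cocompact
    ((Set.Ioc (0 : ℝ) 1).indicator fun x => ((f x : ℝ) : ℂ))
  have h2 : Tendsto (fun M : ℕ => (M : ℝ)) atTop (cocompact ℝ) :=
    tendsto_natCast_atTop_atTop.mono_right atTop_le_cocompact
  have h3 := (Complex.continuous_re.tendsto _).comp (h1.comp h2)
  simp only [Complex.zero_re] at h3
  refine h3.congr fun M => ?_
  simp only [Function.comp_apply]
  have e : ∀ v : ℝ, Real.fourierChar (-(v * M)) • (Set.Ioc (0 : ℝ) 1).indicator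
      (fun x => ((f x : ℝ) : ℂ)) v = (Set.Ioc (0 : ℝ) 1).indicator
      (fun x => expFreq (-M) x * (f x : ℂ)) v := fun v => by
    by_cases hv : v ∈ Set.Ioc (0 : ℝ) 1
    · simp only [Set.indicator_of_mem hv, Circle.smul_def, Real.fourierChar_apply, smul_eq_mul,
        expFreq]
      congr 4; ring
    · simp [Set.indicator_of_notMem hv]
  simp_rw [e]
  rw [integral_indicator measurableSet_Ioc, intervalIntegral.integral_of_le zero_le_one]
  have hi : IntegrableOn (fun x => expFreq (-M) x * (f x : ℂ)) (Set.Ioc (0 : ℝ) 1) :=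
    (Continuous.integrableOn_Icc (by fun_prop)).mono_set Set.Ioc_subset_Icc_self
  have h4 := integral_re (𝕜 := ℂ) hi
  simp only [RCLike.re_to_complex] at h4
  rw [← h4]
  refine integral_congr_ae (Eventually.of_forall fun x => ?_)
  simp only [expFreq, Complex.mul_re, Complex.exp_ofReal_mul_I_re, Complex.ofReal_re,
    Complex.ofReal_im, mul_zero, sub_zero]
  rw [← Real.cos_neg, mul_comm]; congr 2; ring

/-- Squaring the right side leaves the surplus `y²/8 - y³/16 + y⁴/256 ≥ 0`. The negative quadratic
term is what makes each Riesz factor shrink the integral of the square root. -/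
lemma sqrt_one_add_le {y : ℝ} (hy : |y| ≤ 1) : Real.sqrt (1 + y) ≤ 1 + y / 2 - y ^ 2 / 16 := by
  obtain ⟨h1, h2⟩ := abs_le.1 hy
  apply Real.sqrt_le_iff.2
  constructor
  · nlinarith
  · nlinarith [sq_nonneg y, mul_nonneg (sq_nonneg y) (by linarith : 0 ≤ 1 - y), sq_nonneg (y ^ 2)]

/-- Finite Riesz products with lacunary frequencies. -/
lemma exists_riesz_product {r : ℝ} (hr : 0 < r) (hr1 : r ≤ 1) (K : ℕ) :
    ∃ (ι : Type) (_ : Fintype ι) (a : ι → ℂ) (φ : ι → ℤ) (i₀ : ι) (F : ℝ → ℝ),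
      Function.Injective φ ∧ φ i₀ = 0 ∧ a i₀ = 1 ∧ Continuous F ∧ (∀ x, 0 ≤ F x) ∧
      (∀ x, (F x : ℂ) = ∑ i, a i * expFreq (φ i) x) ∧
      (∀ p : ℝ, ∑ i, ‖a i‖ ^ p = (1 + 2 * (r / 2) ^ p) ^ K) ∧
      ∫ x in (0 : ℝ)..1, Real.sqrt (F x) ≤ (1 - r ^ 2 / 64) ^ K := by
  induction K with
  | zero =>
    exact ⟨Unit, inferInstance, fun _ => 1, fun _ => 0, (), fun _ => 1,
      fun _ _ _ => rfl, rfl, rfl, continuous_const, fun _ => zero_le_one, by simp, by simp, by simp⟩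
  | succ K ih =>
    obtain ⟨ι, _, a, φ, i₀, F, hφ, hφ0, ha0, hFc, hF0, hF, hsum, hint⟩ := ih
    set J : ℝ := (1 - r ^ 2 / 64) ^ K with hJ
    have hr2 : r ^ 2 ≤ 1 := by nlinarith
    have hJ0 : 0 < J := by apply pow_pos; linarith
    set s : ℝ → ℝ := fun x => Real.sqrt (F x) with hs
    have hsc : Continuous s := by fun_prop
    have lim1 := tendsto_integral_mul_cos hsc
    have lim2 := lim1.comp (tendsto_id.const_mul_atTop' (r := 2) two_pos)
    have lim : Tendsto (fun M : ℕ =>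
        r / 2 * (∫ x in (0 : ℝ)..1, s x * Real.cos (2 * Real.pi * (M * x))) - r ^ 2 / 32 *
        ∫ x in (0 : ℝ)..1, s x * Real.cos (2 * Real.pi * ((2 * M : ℕ) * x))) atTop (𝓝 0) := by
      simpa using (lim1.const_mul (r / 2)).sub (lim2.const_mul (r ^ 2 / 32))
    obtain ⟨D, hD⟩ : ∃ D : ℕ, ∀ i, |φ i| ≤ D := by
      refine ⟨∑ i, (φ i).natAbs, fun i => ?_⟩
      rw [Int.abs_eq_natAbs]
      exact_mod_cast Finset.single_le_sum (f := fun i => (φ i).natAbs) (fun _ _ => Nat.zero_le _)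
        (Finset.mem_univ i)
    -- By Riemann–Lebesgue the oscillating terms cost at most half of the gain `r²/32`, while `M >
    -- 2D` keeps the three shifted copies of the old spectrum disjoint.
    obtain ⟨M, hM, hMD⟩ := (((tendsto_order.1 lim).2 (r ^ 2 / 64 * J) (by positivity)).and
      (eventually_gt_atTop (2 * D))).exists
    let σ : Fin 3 → ℤ := ![0, 1, -1]
    let b : Fin 3 → ℝ := ![1, r / 2, r / 2]
    have hy : ∀ x, |r * Real.cos (2 * Real.pi * (M * x))| ≤ 1 := fun x => by
      rw [abs_mul, abs_of_pos hr]
      have := Real.abs_cos_le_one (2 * Real.pi * (M * x))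
      nlinarith [abs_nonneg (Real.cos (2 * Real.pi * (M * x)))]
    refine ⟨ι × Fin 3, inferInstance, fun p => a p.1 * b p.2, fun p => φ p.1 + σ p.2 * M, (i₀, 0),
      fun x => F x * (1 + r * Real.cos (2 * Real.pi * (M * x))), ?_, ?_, ?_, ?_, ?_, ?_, ?_, ?_⟩
    · rintro ⟨i, u⟩ ⟨j, v⟩ h
      have h1 := abs_le.1 (hD i)
      have h2 := abs_le.1 (hD j)
      have hM' : (2 * D : ℤ) < M := by exact_mod_cast hMD
      have huv : u = v := by
        fin_cases u <;> fin_cases v <;> simp [σ] at h ⊢ <;> omega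
      subst huv
      have : φ i = φ j := by simpa using h
      rw [hφ this]
    · simp [σ, hφ0]
    · simp [b, ha0]
    · fun_prop
    · intro x
      have := (abs_le.1 (hy x)).1
      exact mul_nonneg (hF0 x) (by linarith)
    · intro x
      have e : (1 : ℂ) + r * Complex.cos (2 * Real.pi * (M * x)) =
          ∑ u, (b u : ℂ) * expFreq (σ u * M) x := by
        simp only [Fin.sum_univ_three, b, σ, expFreq]
        simp [Complex.cos]
        ring_nf
      push_cast
      rw [hF, e, Finset.sum_mul_sum, Fintype.sum_prod_type]
      refine Finset.sum_congr rfl fun i _ => Finset.sum_congr rfl fun u _ => ?_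
      rw [expFreq_add]; ring
    · intro p
      rw [pow_succ, ← hsum, Fintype.sum_prod_type]
      have e : (1 + 2 * (r / 2) ^ p) = ∑ u, ‖(b u : ℂ)‖ ^ p := by
        simp [Fin.sum_univ_three, b, abs_of_pos (half_pos hr)]; ring
      rw [e, Finset.sum_mul_sum]
      refine Finset.sum_congr rfl fun i _ => Finset.sum_congr rfl fun u _ => ?_
      simp only [norm_mul]
      rw [Real.mul_rpow (norm_nonneg _) (norm_nonneg _)]
    · have hle : ∀ x, Real.sqrt (F x * (1 + r * Real.cos (2 * Real.pi * (M * x)))) ≤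
          (1 - r ^ 2 / 32) * s x + (r / 2 * (s x * Real.cos (2 * Real.pi * (M * x))) -
            r ^ 2 / 32 * (s x * Real.cos (2 * Real.pi * ((2 * M : ℕ) * x)))) := by
        intro x
        rw [Real.sqrt_mul (hF0 x)]
        have h1 := sqrt_one_add_le (hy x)
        have h2 := mul_le_mul_of_nonneg_left h1 (Real.sqrt_nonneg (F x))
        have h3 : Real.cos (2 * Real.pi * ((2 * M : ℕ) * x)) =
            2 * Real.cos (2 * Real.pi * (M * x)) ^ 2 - 1 := by
          rw [← Real.cos_two_mul]; congr 1; push_cast; ring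
        rw [h3]
        refine h2.trans (le_of_eq ?_)
        simp only [hs]; ring
      have i1 : IntervalIntegrable s volume 0 1 := hsc.intervalIntegrable _ _
      have i2 : ∀ N : ℕ, IntervalIntegrable
          (fun x => s x * Real.cos (2 * Real.pi * (N * x))) volume 0 1 :=
        fun N => Continuous.intervalIntegrable (by fun_prop) _ _
      calc _ ≤ _ := intervalIntegral.integral_mono_on zero_le_one
              (Continuous.intervalIntegrable (by fun_prop) _ _)
              (Continuous.intervalIntegrable (by fun_prop) _ _) (fun x _ => hle x)
        _ = (1 - r ^ 2 / 32) * (∫ x in (0 : ℝ)..1, s x) + _ := by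
            rw [intervalIntegral.integral_add (i1.const_mul _)
              (((i2 _).const_mul _).sub ((i2 _).const_mul _)), intervalIntegral.integral_sub
              ((i2 _).const_mul _) ((i2 _).const_mul _), intervalIntegral.integral_const_mul,
              intervalIntegral.integral_const_mul, intervalIntegral.integral_const_mul]
        _ ≤ (1 - r ^ 2 / 32) * J + r ^ 2 / 64 * J := by
            refine add_le_add (mul_le_mul_of_nonneg_left hint (by linarith)) hM.le
        _ = _ := by rw [pow_succ (1 - r ^ 2 / 64) K, ← hJ]; ring

/-- Trigonometric polynomials with constant term `1`, small in measure, bounded in `ℓ²`, and with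
nonconstant coefficients arbitrarily small in `ℓ^q`. -/
lemma exists_small_trigPoly {q : ℝ} (hq : 2 < q) {η : ℝ} (hη : 0 < η) :
    ∃ E : ℝ, ∀ κ : ℝ, 0 < κ → ∃ (ι : Type) (_ : Fintype ι) (_ : DecidableEq ι) (a : ι → ℂ)
      (φ : ι → ℤ) (i₀ : ι), Function.Injective φ ∧ φ i₀ = 0 ∧ a i₀ = 1 ∧
      ∫ x in (0 : ℝ)..1, min 1 ‖∑ i, a i * expFreq (φ i) x‖ ≤ η ∧
      ∑ i, ‖a i‖ ^ 2 ≤ E ∧ ∑ i ∈ Finset.univ.erase i₀, ‖a i‖ ^ q ≤ κ := by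
  -- `A` is the target for `K r²`. As `min(1, F) ≤ √F`, the integral is at most `(1 - r²/64)^K ≤
  -- exp(-A/64)`. The `ℓ²` sum is `(1 + r²/2)^K ≤ exp((A+1)/2)`, independently of `κ`.
  obtain ⟨A, hA0, hA⟩ : ∃ A : ℝ, 0 < A ∧ Real.exp (-(A / 64)) ≤ η := by
    refine ⟨64 * (|Real.log η| + 1), by positivity, ?_⟩
    rw [← Real.le_log_iff_exp_le hη]
    have := neg_abs_le (Real.log η)
    linarith
  refine ⟨Real.exp ((A + 1) / 2), fun κ hκ => ?_⟩
  -- This is where `q > 2` enters: `K r^q = K r² · r^(q-2)` is small although `K r²` is not.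
  obtain ⟨r, hr0, hr1, hr⟩ : ∃ r : ℝ, 0 < r ∧ r ≤ 1 ∧ (A + 1) * r ^ (q - 2) ≤ Real.log (1 + κ) := by
    have h1 : Tendsto (fun r : ℝ => (A + 1) * r ^ (q - 2)) (𝓝[>] 0) (𝓝 0) := by
      have := ((Real.continuousAt_rpow_const 0 (q - 2) (Or.inr (by linarith))).tendsto.const_mul
        (A + 1)).mono_left (nhdsWithin_le_nhds (s := Set.Ioi 0))
      rwa [Real.zero_rpow (by linarith), mul_zero] at this
    have h2 := (tendsto_order.1 h1).2 (Real.log (1 + κ)) (Real.log_pos (by linarith))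
    have h3 : Set.Ioc (0 : ℝ) 1 ∈ 𝓝[>] (0 : ℝ) := Ioc_mem_nhdsGT one_pos
    obtain ⟨r, hr, hr'⟩ := (h2.and h3).exists
    exact ⟨r, hr'.1, hr'.2, hr.le⟩
  set K := ⌈A / r ^ 2⌉₊
  have hr2 : 0 < r ^ 2 := by positivity
  have hK1 : A ≤ K * r ^ 2 := by
    have := Nat.le_ceil (A / r ^ 2)
    rwa [div_le_iff₀ hr2] at this
  have hK2 : K * r ^ 2 ≤ A + 1 := by
    have := (Nat.ceil_lt_add_one (by positivity : 0 ≤ A / r ^ 2)).le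
    calc K * r ^ 2 ≤ (A / r ^ 2 + 1) * r ^ 2 := by gcongr
      _ = A + r ^ 2 := by field_simp
      _ ≤ A + 1 := by nlinarith
  have hexp : ∀ {y : ℝ}, 0 ≤ 1 + y → (1 + y) ^ K ≤ Real.exp (K * y) := fun {y} hy => by
    rw [Real.exp_nat_mul]
    exact pow_le_pow_left₀ hy (by linarith [Real.add_one_le_exp y]) _
  obtain ⟨ι, _, a, φ, i₀, F, hφ, hφ0, ha0, hFc, hF0, hF, hsum, hint⟩ :=
    exists_riesz_product hr0 hr1 K
  classical
  refine ⟨ι, inferInstance, inferInstance, a, φ, i₀, hφ, hφ0, ha0, ?_, ?_, ?_⟩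
  · simp_rw [← hF]
    calc _ ≤ ∫ x in (0 : ℝ)..1, Real.sqrt (F x) := by
          apply intervalIntegral.integral_mono_on zero_le_one
          · exact Continuous.intervalIntegrable (by fun_prop) _ _
          · exact Continuous.intervalIntegrable (by fun_prop) _ _
          intro x _
          rw [Complex.norm_real, Real.norm_of_nonneg (hF0 x)]
          rcases le_total (F x) 1 with h | h
          · refine (min_le_right _ _).trans (Real.le_sqrt_of_sq_le ?_)
            nlinarith [hF0 x]
          · exact (min_le_left _ _).trans (Real.one_le_sqrt.2 h)
      _ ≤ (1 + -(r ^ 2 / 64)) ^ K := by rw [← sub_eq_add_neg]; exact hint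
      _ ≤ Real.exp (K * -(r ^ 2 / 64)) := hexp (by nlinarith)
      _ ≤ Real.exp (-(A / 64)) := Real.exp_le_exp.2 (by linarith)
      _ ≤ η := hA
  · have := hsum 2
    simp only [Real.rpow_two] at this
    rw [this]
    refine (hexp (by positivity)).trans (Real.exp_le_exp.2 ?_)
    linarith
  · have h1 := Finset.add_sum_erase Finset.univ (fun i => ‖a i‖ ^ q) (Finset.mem_univ i₀)
    rw [hsum] at h1
    have h2 : 2 * (r / 2) ^ q ≤ r ^ q := by
      rw [Real.div_rpow hr0.le zero_le_two]
      have h3 : (2 : ℝ) ≤ 2 ^ q := by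
        calc (2 : ℝ) = 2 ^ (1 : ℝ) := by simp
          _ ≤ _ := Real.rpow_le_rpow_of_exponent_le (by norm_num) (by linarith)
      have h4 : 0 ≤ r ^ q := by positivity
      rw [mul_div_assoc', div_le_iff₀ (by positivity)]
      nlinarith
    have h5 : r ^ q = r ^ 2 * r ^ (q - 2) := by
      rw [← Real.rpow_two, ← Real.rpow_add hr0]; congr 1; ring
    have h6 : (1 + 2 * (r / 2) ^ q) ^ K ≤ 1 + κ := by
      refine (hexp (by positivity)).trans ?_
      rw [← Real.le_log_iff_exp_le (by linarith)]
      refine le_trans ?_ hr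
      calc K * (2 * (r / 2) ^ q) ≤ K * (r ^ 2 * r ^ (q - 2)) := by rw [← h5]; gcongr
        _ = K * r ^ 2 * r ^ (q - 2) := by ring
        _ ≤ _ := by gcongr
    simp only [ha0, norm_one, Real.one_rpow] at h1
    linarith

/-! ### Small coefficients and positive frequencies. -/

lemma intervalIntegral_comp_nat_mul_of_periodic {f : ℝ → ℝ} (hc : Continuous f)
    (hf : Function.Periodic f 1)
    {R : ℕ} (hR : 0 < R) (a b : ℤ) :
    ∫ x in (a : ℝ)..b, f (R * x) = (b - a) * ∫ x in (0 : ℝ)..1, f x := by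
  have hR' : (R : ℝ) ≠ 0 := by positivity
  rw [intervalIntegral.integral_comp_mul_left _ hR']
  have h1 := hf.intervalIntegral_add_zsmul_eq (R * (b - a)) (R * a)
    fun _ _ => hc.intervalIntegrable _ _
  have h2 : (R * a : ℝ) + ((R : ℤ) * (b - a)) • (1 : ℝ) = R * b := by
    simp; ring
  rw [h2, hf.intervalIntegral_add_eq (R * a) 0] at h1
  rw [h1]
  simp
  field_simp

lemma intervalIntegral_comp_nat_mul_unit {f : ℝ → ℝ} (hc : Continuous f)
    (hf : Function.Periodic f 1)
    {R : ℕ} (hR : 0 < R) : ∫ x in (0 : ℝ)..1, f (R * x) = ∫ x in (0 : ℝ)..1, f x := by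
  simpa using intervalIntegral_comp_nat_mul_of_periodic hc hf hR 0 1

lemma integral_norm_sq_trigPoly {ι : Type*} (s : Finset ι) (a : ι → ℂ) {φ : ι → ℤ}
    (hφ : Function.Injective φ) :
    ∫ x in (0 : ℝ)..1, ‖∑ i ∈ s, a i * expFreq (φ i) x‖ ^ 2 = ∑ i ∈ s, ‖a i‖ ^ 2 := by
  have e : ∀ x : ℝ, ((‖∑ i ∈ s, a i * expFreq (φ i) x‖ ^ 2 : ℝ) : ℂ) =
      ∑ i ∈ s, ∑ j ∈ s, a i * (starRingEnd ℂ) (a j) * expFreq ((φ i - φ j : ℤ)) x := fun x => by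
    rw [← Complex.normSq_eq_norm_sq, Complex.normSq_eq_conj_mul_self, mul_comm, map_sum,
      Finset.sum_mul_sum]
    refine Finset.sum_congr rfl fun i _ => Finset.sum_congr rfl fun j _ => ?_
    rw [map_mul, conj_expFreq]
    push_cast
    rw [sub_eq_add_neg, expFreq_add]; ring
  have h : ((∫ x in (0 : ℝ)..1, ‖∑ i ∈ s, a i * expFreq (φ i) x‖ ^ 2 : ℝ) : ℂ) =
      ((∑ i ∈ s, ‖a i‖ ^ 2 : ℝ) : ℂ) := by
    rw [← intervalIntegral.integral_ofReal]
    simp_rw [e]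
    rw [intervalIntegral.integral_finsetSum fun i _ =>
      Continuous.intervalIntegrable (by fun_prop) _ _]
    rw [Complex.ofReal_sum]
    refine Finset.sum_congr rfl fun i hi => ?_
    rw [intervalIntegral.integral_finsetSum fun i _ =>
      Continuous.intervalIntegrable (by fun_prop) _ _]
    rw [Finset.sum_eq_single i]
    · simp [Complex.mul_conj, Complex.normSq_eq_norm_sq]
    · intro j _ hj
      rw [intervalIntegral.integral_const_mul, integral_expFreq_intCast, mul_zero]
      exact sub_ne_zero.2 fun h => hj (hφ h).symm
    · exact fun h => absurd hi h
  exact_mod_cast h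

/-- Quantifying over `G` after `c` lets the same coefficients serve both the sum of vectors and the
`ℓ^q` sum. -/
lemma exists_finsupp_of_injOn {α β : Type*} (s : Finset α) (A : α → ℂ) {ν : α → β}
    (hν : Set.InjOn ν s) :
    ∃ c : β →₀ ℂ, ∀ {γ : Type} [AddCommMonoid γ] (G : β → ℂ → γ), (∀ n, G n 0 = 0) →
      c.sum G = ∑ u ∈ s, G (ν u) (A u) := by
  classical
  set c : β →₀ ℂ := ∑ u ∈ s, Finsupp.single (ν u) (A u) with hc
  have h1 : ∀ u ∈ s, c (ν u) = A u := fun u hu => by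
    rw [hc, Finsupp.finsetSum_apply, Finset.sum_eq_single_of_mem u hu, Finsupp.single_eq_same]
    intro v hv hvu
    exact Finsupp.single_eq_of_ne fun h => hvu (hν hv hu h.symm)
  have hsub : c.support ⊆ s.image ν := by
    refine Finsupp.support_finsetSum.trans (Finset.biUnion_subset.2 fun u hu => ?_)
    refine Finsupp.support_single_subset.trans ?_
    simpa using ⟨u, hu, rfl⟩
  refine ⟨c, fun {γ} _ G hG => ?_⟩
  rw [Finsupp.sum_of_support_subset c hsub G fun n _ => hG n, Finset.sum_image hν]
  exact Finset.sum_congr rfl fun u hu => by rw [h1 u hu]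

lemma exists_coeff_of_injOn {α : Type*} (s : Finset α) (A : α → ℂ) {ψ : α → ℤ}
    (hψ : Set.InjOn ψ s) (hpos : ∀ u ∈ s, 0 < ψ u) :
    ∃ (D : ℕ) (c : ℕ → ℂ), ∀ {β : Type} [AddCommMonoid β] (G : ℤ → ℂ → β), (∀ n, G n 0 = 0) →
      ∑ n ∈ Finset.range D, G (n + 1) (c n) = ∑ u ∈ s, G (ψ u) (A u) := by
  set ν : α → ℕ := fun u => (ψ u - 1).toNat with hν
  have hν1 : ∀ u ∈ s, (ν u : ℤ) + 1 = ψ u := fun u hu => by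
    have := hpos u hu
    simp only [hν]; omega
  have hinj : Set.InjOn ν s := fun u hu v hv h => hψ hu hv (by
    rw [← hν1 u hu, ← hν1 v hv, h])
  obtain ⟨c, hc⟩ := exists_finsupp_of_injOn s A hinj
  refine ⟨c.support.sup id + 1, c, fun {β} _ G hG => ?_⟩
  rw [← Finsupp.sum_of_support_subset c (s := Finset.range (c.support.sup id + 1))
    (fun n hn => Finset.mem_range_succ_iff.2 (Finset.le_sup (f := id) hn))
    (fun n z => G (n + 1) z) fun n _ => hG _, hc (fun n z => G (n + 1) z) fun n => hG _]
  exact Finset.sum_congr rfl fun u hu => by rw [hν1 u hu]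

/-- Polynomials without constant term and with small `ℓ^q` norm of the coefficients approximate
`1` in measure on the unit circle, for every `q > 2`. -/
lemma exists_small_coeff_approx_one {q : ℝ} (hq : 2 < q) {δ : ℝ} (hδ : 0 < δ) :
    ∃ (D : ℕ) (c : ℕ → ℂ), ∑ n ∈ Finset.range D, ‖c n‖ ^ q ≤ δ ∧
      ∫ x in (0 : ℝ)..1, min 1 ‖1 - ∑ n ∈ Finset.range D, c n * expFreq (n + 1) x‖ ≤ δ := by
  -- The order of choices matters: `E` does not depend on `κ`, so `M` and `T` can be fixed before
  -- the trigonometric polynomial, and `κ = δ / (1 + B)` can then absorb the coefficients of `T`.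
  obtain ⟨E, hE⟩ := exists_small_trigPoly hq (η := δ / 4) (by positivity)
  obtain ⟨M, hM0, hM⟩ : ∃ M : ℝ, 0 < M ∧ E / M ^ 2 ≤ δ / 4 := by
    have : Tendsto (fun M : ℝ => E / M ^ 2) atTop (𝓝 0) :=
      tendsto_const_nhds.div_atTop (tendsto_pow_atTop two_ne_zero)
    obtain ⟨M, hM, hM'⟩ := (((tendsto_order.1 this).2 (δ / 4) (by positivity)).and
      (eventually_gt_atTop 0)).exists
    exact ⟨M, hM', hM.le⟩
  obtain ⟨T, hT0, hT⟩ := exists_polynomial_approx_one M hM0.le (δ := δ / 4) (by positivity)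
  set B := ∑ l ∈ T.support, ‖T.coeff l‖ ^ q
  have hB : 0 ≤ B := Finset.sum_nonneg fun _ _ => by positivity
  obtain ⟨ι, _, _, a, φ, i₀, hφ, hφ0, ha0, hint, hsq, hsum⟩ := hE (δ / (1 + B)) (by positivity)
  obtain ⟨d, hd⟩ : ∃ d : ℕ, ∀ i, |φ i| ≤ d := by
    refine ⟨∑ i, (φ i).natAbs, fun i => ?_⟩
    rw [Int.abs_eq_natAbs]
    exact_mod_cast Finset.single_le_sum (f := fun i => (φ i).natAbs) (fun _ _ => Nat.zero_le _)
      (Finset.mem_univ i)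
  -- The spectrum lies in `[-d, d]`, so its shifts by multiples of `L` are disjoint, and those by `L
  -- l` with `l ≥ 1` are positive.
  set L : ℕ := 2 * d + 1 with hL
  set sp : Finset ι := Finset.univ.filter fun i => 0 < φ i with hsp
  set sn : Finset ι := Finset.univ.filter fun i => φ i < 0 with hsn
  have hdisj : Disjoint sp sn := by
    rw [Finset.disjoint_filter]; intro i _ h; omega
  have hunion : Finset.univ.erase i₀ = sp ∪ sn := by
    ext i
    simp only [Finset.mem_erase, Finset.mem_univ, and_true, Finset.mem_union, hsp, hsn,
      Finset.mem_filter, true_and]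
    rw [← hφ.ne_iff, hφ0]; omega
  have hsupp : ∀ l ∈ T.support, 1 ≤ l := fun l hl => by
    rw [Nat.one_le_iff_ne_zero]; rintro rfl
    exact (Polynomial.mem_support_iff.1 hl) hT0
  have hLl : ∀ l ∈ T.support, (L : ℤ) ≤ L * l := fun l hl => by
    have : (1 : ℤ) ≤ l := by exact_mod_cast hsupp l hl
    nlinarith
  let ψ : ι ⊕ (ι × ℕ) → ℤ := Sum.elim φ fun p => φ p.1 + L * p.2
  let A : ι ⊕ (ι × ℕ) → ℂ := Sum.elim (fun i => -a i) fun p => -(a p.1 * T.coeff p.2)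
  set s := sp.disjSum (sn ×ˢ T.support) with hs
  have hLd : (L : ℤ) = 2 * d + 1 := by simp [hL]
  have hinj : Set.InjOn ψ s := by
    rintro (i | ⟨i, l⟩) hu (j | ⟨j, m⟩) hv h
    · exact congrArg _ (hφ h)
    · exfalso
      simp only [hs, Finset.mem_coe, Finset.inr_mem_disjSum, Finset.mem_product] at hv
      have h1 := abs_le.1 (hd i); have h2 := abs_le.1 (hd j); have h3 := hLl m hv.2
      simp only [ψ, Sum.elim_inl, Sum.elim_inr] at h
      omega
    · exfalso
      simp only [hs, Finset.mem_coe, Finset.inr_mem_disjSum, Finset.mem_product] at hu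
      have h1 := abs_le.1 (hd i); have h2 := abs_le.1 (hd j); have h3 := hLl l hu.2
      simp only [ψ, Sum.elim_inl, Sum.elim_inr] at h
      omega
    · have h1 := abs_le.1 (hd i); have h2 := abs_le.1 (hd j)
      simp only [ψ, Sum.elim_inr] at h
      have hlm : l = m := by
        rcases lt_trichotomy (l : ℤ) m with h3 | h3 | h3
        · nlinarith
        · exact_mod_cast h3
        · nlinarith
      subst hlm
      have : φ i = φ j := by linarith
      rw [hφ this]
  have hpos : ∀ u ∈ s, 0 < ψ u := by
    rintro (i | ⟨i, l⟩) hu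
    · simpa [hs, hsp, ψ] using hu
    · simp only [hs, Finset.inr_mem_disjSum, Finset.mem_product] at hu
      have h1 := abs_le.1 (hd i); have h3 := hLl l hu.2
      simp only [ψ, Sum.elim_inr]; omega
  obtain ⟨D, c, hc⟩ := exists_coeff_of_injOn s A hinj hpos
  have hq0 : q ≠ 0 := by linarith
  refine ⟨D, c, ?_, ?_⟩
  · rw [hc (fun _ z => ‖z‖ ^ q) (fun _ => by simp [hq0]), hs, Finset.sum_disjSum,
      Finset.sum_product]
    simp only [A, Sum.elim_inl, Sum.elim_inr, norm_neg, norm_mul,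
      Real.mul_rpow (norm_nonneg _) (norm_nonneg _)]
    simp_rw [← Finset.mul_sum]
    rw [← Finset.sum_mul]
    rw [hunion, Finset.sum_union hdisj] at hsum
    have h1 : 0 ≤ ∑ i ∈ sp, ‖a i‖ ^ q := Finset.sum_nonneg fun _ _ => by positivity
    have h2 : 0 ≤ ∑ i ∈ sn, ‖a i‖ ^ q := Finset.sum_nonneg fun _ _ => by positivity
    rw [le_div_iff₀ (by positivity)] at hsum
    change _ + _ * B ≤ δ
    nlinarith
  · have hP : ∀ x, ∑ n ∈ Finset.range D, c n * expFreq (n + 1) x =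
        -(∑ i ∈ sp, a i * expFreq (φ i) x) -
          (∑ i ∈ sn, a i * expFreq (φ i) x) * T.eval (expFreq 1 (L * x)) := fun x => by
      have h1 := hc (fun n z => z * expFreq n x) (fun _ => by simp)
      push_cast at h1
      rw [h1, hs, Finset.sum_disjSum, Finset.sum_product, Polynomial.eval_eq_sum,
        Polynomial.sum_def, Finset.sum_mul_sum, ← Finset.sum_neg_distrib, sub_eq_add_neg,
        ← Finset.sum_neg_distrib]
      congr 1
      · exact Finset.sum_congr rfl fun i _ => by simp [A, ψ]
      · refine Finset.sum_congr rfl fun i _ => ?_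
        rw [← Finset.sum_neg_distrib]
        refine Finset.sum_congr rfl fun l _ => ?_
        simp only [A, ψ, Sum.elim_inr]
        push_cast
        rw [expFreq_add, expFreq_pow, mul_one, mul_comm (L : ℝ) l, expFreq_mul]; ring
    have hF : ∀ x, ∑ i, a i * expFreq (φ i) x =
        1 + (∑ i ∈ sp, a i * expFreq (φ i) x + ∑ i ∈ sn, a i * expFreq (φ i) x) := fun x => by
      rw [← Finset.add_sum_erase Finset.univ _ (Finset.mem_univ i₀), hunion,
        Finset.sum_union hdisj, ha0, hφ0]
      simp
    set Pn : ℝ → ℂ := fun x => ∑ i ∈ sn, a i * expFreq (φ i) x with hPn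
    have hper : Function.Periodic (fun x => min 1 (M * ‖T.eval (expFreq 1 x) - 1‖)) 1 := fun x => by
      have := expFreq_periodic 1 x
      simp only [Int.cast_one] at this
      simp only [this]
    have hTL := intervalIntegral_comp_nat_mul_unit (by fun_prop) hper (R := L) (by omega)
    have i1 : IntervalIntegrable (fun x => min 1 ‖∑ i, a i * expFreq (φ i) x‖) volume 0 1 :=
      Continuous.intervalIntegrable (by fun_prop) _ _
    have i2 : IntervalIntegrable (fun x : ℝ => min 1 (M * ‖T.eval (expFreq 1 (L * x)) - 1‖))
      volume 0 1 := Continuous.intervalIntegrable (by fun_prop) _ _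
    have i3 : IntervalIntegrable (fun x => ‖Pn x‖ ^ 2 / M ^ 2) volume 0 1 :=
      Continuous.intervalIntegrable (by fun_prop) _ _
    calc _ ≤ ∫ x in (0 : ℝ)..1, (min 1 ‖∑ i, a i * expFreq (φ i) x‖ +
          min 1 (M * ‖T.eval (expFreq 1 (L * x)) - 1‖) + ‖Pn x‖ ^ 2 / M ^ 2) := by
          apply intervalIntegral.integral_mono_on zero_le_one
          · exact Continuous.intervalIntegrable (by fun_prop) _ _
          · exact (i1.add i2).add i3
          intro x _
          have e : 1 - ∑ n ∈ Finset.range D, c n * expFreq (n + 1) x =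
              ∑ i, a i * expFreq (φ i) x + Pn x * (T.eval (expFreq 1 (L * x)) - 1) := by
            rw [hP, hF]; ring
          rw [e]
          set τ := ‖T.eval (expFreq 1 (L * x)) - 1‖ with hτ
          -- Chebyshev's inequality in pointwise form: the last term is at least `1` where `‖Pn x‖ ≥
          -- M`.
          have h1 : min 1 (‖Pn x‖ * τ) ≤ min 1 (M * τ) + ‖Pn x‖ ^ 2 / M ^ 2 := by
            have h0 : 0 ≤ min 1 (M * τ) := by positivity
            rcases le_total ‖Pn x‖ M with h | h
            · have : min 1 (‖Pn x‖ * τ) ≤ min 1 (M * τ) := by gcongr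
              have : 0 ≤ ‖Pn x‖ ^ 2 / M ^ 2 := by positivity
              linarith
            · have : 1 ≤ ‖Pn x‖ ^ 2 / M ^ 2 := by
                rw [one_le_div (by positivity)]; gcongr
              linarith [min_le_left 1 (‖Pn x‖ * τ)]
          calc _ ≤ min 1 (‖∑ i, a i * expFreq (φ i) x‖ + ‖Pn x‖ * τ) := by
                gcongr
                refine (norm_add_le _ _).trans ?_
                rw [norm_mul]
            _ ≤ _ := by
                rw [add_assoc]
                exact (min_one_add_le (norm_nonneg _) (by positivity)).trans (by gcongr)
      _ = (∫ x in (0 : ℝ)..1, min 1 ‖∑ i, a i * expFreq (φ i) x‖) +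
          (∫ x in (0 : ℝ)..1, min 1 (M * ‖T.eval (expFreq 1 (L * x)) - 1‖)) +
          (∑ i ∈ sn, ‖a i‖ ^ 2) / M ^ 2 := by
          rw [intervalIntegral.integral_add (i1.add i2) i3, intervalIntegral.integral_add i1 i2,
            intervalIntegral.integral_div, integral_norm_sq_trigPoly _ _ hφ]
      _ ≤ δ / 4 + δ / 4 + δ / 4 := by
          refine add_le_add (add_le_add hint (hTL.trans_le hT.le)) (le_trans ?_ hM)
          gcongr
          exact (Finset.sum_le_univ_sum_of_nonneg fun _ => by positivity).trans hsq
      _ ≤ δ := by linarith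

/-! ### Quasi-lacunary sequences containing long progressions. -/

/-- A quasi-lacunary sequence which runs through arithmetic progressions of prescribed lengths `D j`
and prescribed offsets `k j`. -/
lemma exists_lacunary_blocks {ε : ℕ → ℝ} (hε : ∀ n, 0 < ε n) (hε0 : Tendsto ε atTop (𝓝 0))
    (D : ℕ → ℕ) (k : ℕ → ℝ) :
    ∃ (lam : ℕ → ℝ) (N R : ℕ → ℕ), (∀ n, 0 < lam n) ∧ (∀ n, lam n + 1 ≤ lam (n + 1)) ∧
      (∀ n, (1 + ε n) * lam n < lam (n + 1)) ∧ (∀ j, 0 < R j) ∧ (∀ j, N j + D j ≤ N (j + 1)) ∧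
      ∀ j, ∀ i < D j, lam (N j + i) = k j + R j * (i + 1) := by
  classical
  -- Block `j` will start after `t j`. Its terms, except the last, are at most `r (D j + 2)`, where
  -- `r` is its step, so `ε n` times such a term is less than `r`.
  have ht : ∀ j, ∃ t, ∀ n ≥ t, ε n * (D j + 2) < 1 := fun j => by
    have h1 := hε0.mul_const ((D j : ℝ) + 2)
    rw [zero_mul] at h1
    exact eventually_atTop.1 ((tendsto_order.1 h1).2 1 one_pos)
  choose t ht using ht
  let N : ℕ → ℕ := fun j => ∑ i ∈ Finset.range j, D i + ∑ i ∈ Finset.range (j + 1), t i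
  have hN : ∀ j, N j + D j ≤ N (j + 1) := fun j => by
    simp only [N, Finset.sum_range_succ]; omega
  have hNt : ∀ j, t j ≤ N j := fun j => by
    simp only [N, Finset.sum_range_succ]; omega
  have hmono : Monotone N := monotone_nat_of_le_succ fun j => by have := hN j; omega
  have huniq : ∀ {j i j' i'}, i < D j → i' < D j' → N j + i = N j' + i' → j = j' := by
    intro j i j' i' hi hi' h
    rcases lt_trichotomy j j' with h1 | h1 | h1
    · have := hN j; have := hmono (Nat.succ_le_of_lt h1); simp only [Nat.succ_eq_add_one] at this
      omega
    · exact h1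
    · have := hN j'; have := hmono (Nat.succ_le_of_lt h1); simp only [Nat.succ_eq_add_one] at this
      omega
  obtain ⟨kap, m, hm, hkm⟩ : ∃ (kap : ℕ → ℝ) (m : ℕ → ℕ), (∀ n, 1 ≤ m n) ∧
      ∀ j, ∀ i < D j, kap (N j + i) = k j ∧ m (N j + i) = i + 1 := by
    have : ∀ n, ∃ p : ℝ × ℕ, 1 ≤ p.2 ∧ ∀ j, ∀ i < D j, n = N j + i → p = (k j, i + 1) := by
      intro n
      by_cases h : ∃ j i, i < D j ∧ n = N j + i
      · obtain ⟨j, i, hi, rfl⟩ := h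
        refine ⟨(k j, i + 1), by simp, fun j' i' hi' h' => ?_⟩
        obtain rfl := huniq hi hi' h'
        have : i = i' := by omega
        rw [this]
      -- Indices outside all blocks are fillers, with term `ρ n`.
      · exact ⟨(0, 1), le_rfl, fun j i hi h' => absurd ⟨j, i, hi, h'⟩ h⟩
    choose p hp hp' using this
    refine ⟨fun n => (p n).1, fun n => (p n).2, hp, fun j i hi => ?_⟩
    beta_reduce
    rw [hp' _ j i hi rfl]; exact ⟨rfl, rfl⟩
  let cont : ℕ → Prop := fun n => ∃ j i, i + 1 < D j ∧ n = N j + i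
  -- The step is constant within a block. Otherwise it jumps far enough that the next term exceeds
  -- both required lower bounds whatever the offset; `ρ n ≥ |kap n| + 1` also ensures positivity.
  obtain ⟨ρ, hρ0, hρs⟩ : ∃ ρ : ℕ → ℕ, ρ 0 = ⌈|kap 0|⌉₊ + 1 ∧ ∀ n, ρ (n + 1) = if cont n then ρ n
      else ⌈|kap (n + 1)|⌉₊ + ⌈(1 + ε n) * (|kap n| + (ρ n : ℝ) * m n)⌉₊ + 2 :=
    ⟨fun n => Nat.rec (motive := fun _ => ℕ) (⌈|kap 0|⌉₊ + 1) (fun n r => if cont n then r else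
      ⌈|kap (n + 1)|⌉₊ + ⌈(1 + ε n) * (|kap n| + (r : ℝ) * m n)⌉₊ + 2) n, rfl, fun _ => rfl⟩
  have hρ : ∀ n, |kap n| + 1 ≤ ρ n := by
    intro n
    induction n with
    | zero =>
      rw [hρ0]; push_cast; linarith [Nat.le_ceil |kap 0|]
    | succ n ih =>
      rw [hρs]
      split_ifs with h
      · obtain ⟨j, i, hi, rfl⟩ := h
        rw [add_assoc, (hkm j (i + 1) hi).1]
        rwa [(hkm j i (by omega)).1] at ih
      · push_cast
        have h1 := Nat.le_ceil |kap (n + 1)|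
        have h2 : (0 : ℝ) ≤ ⌈(1 + ε n) * (|kap n| + ρ n * m n)⌉₊ := Nat.cast_nonneg _
        linarith
  have hρ1 : ∀ n, (1 : ℝ) ≤ ρ n := fun n => by linarith [hρ n, abs_nonneg (kap n)]
  have hm' : ∀ n, (1 : ℝ) ≤ m n := fun n => by exact_mod_cast hm n
  have hbd : ∀ n, kap n + ρ n * m n ≤ |kap n| + ρ n * m n := fun n => by
    linarith [le_abs_self (kap n)]
  have hlow : ∀ n, (ρ n : ℝ) - |kap n| ≤ kap n + ρ n * m n := fun n => by
    nlinarith [neg_abs_le (kap n), hρ1 n, hm' n]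
  have hstep : ∀ n, kap n + ρ n * m n + 1 ≤ kap (n + 1) + ρ (n + 1) * m (n + 1) ∧
      (1 + ε n) * (kap n + ρ n * m n) < kap (n + 1) + ρ (n + 1) * m (n + 1) := by
    intro n
    by_cases h : cont n
    · have e : ρ (n + 1) = ρ n := by rw [hρs, if_pos h]
      rw [e]
      have h3 := hρ n
      have h4 := hρ1 n
      obtain ⟨j, i, hi, rfl⟩ := h
      have h1 := hkm j i (by omega)
      have h2 := hkm j (i + 1) hi
      rw [← add_assoc] at h2
      rw [h1.1, h1.2, h2.1, h2.2]
      rw [h1.1] at h3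
      set r : ℝ := Nat.cast (ρ (N j + i))
      push_cast
      refine ⟨by nlinarith, ?_⟩
      have h5 := ht j (N j + i) (by have := hNt j; omega)
      have h6 := hε (N j + i)
      have h7 : (i : ℝ) + 1 < D j := by exact_mod_cast hi
      have h8 : k j + r * (i + 1) ≤ r * (D j + 2) := by
        nlinarith [le_abs_self (k j)]
      nlinarith [mul_le_mul_of_nonneg_left h8 h6.le]
    · have h0 := hρs n
      rw [if_neg h] at h0
      have h1 := Nat.le_ceil |kap (n + 1)|
      have h2 := Nat.le_ceil ((1 + ε n) * (|kap n| + ρ n * m n))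
      have h3 := hlow (n + 1)
      have h4 : (ρ (n + 1) : ℝ) = ⌈|kap (n + 1)|⌉₊ + ⌈(1 + ε n) * (|kap n| + ρ n * m n)⌉₊ + 2 := by
        exact_mod_cast h0
      have h5 := hε n
      have h6 : 0 ≤ |kap n| + ρ n * m n := by positivity
      constructor
      · nlinarith [hbd n]
      · nlinarith [hbd n, mul_le_mul_of_nonneg_left (hbd n) (by linarith : 0 ≤ 1 + ε n)]
  refine ⟨fun n => kap n + ρ n * m n, N, fun j => ρ (N j), fun n => ?_, fun n => (hstep n).1,
    fun n => (hstep n).2, fun j => ?_, hN, fun j i hi => ?_⟩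
  · linarith [hlow n, hρ n]
  · exact_mod_cast (zero_lt_one.trans_le (hρ1 (N j)) : (0 : ℝ) < ρ (N j))
  · have hc : ∀ i < D j, ρ (N j + i) = ρ (N j) := by
      intro i
      induction i with
      | zero => simp
      | succ i ih =>
        intro hi
        rw [← add_assoc, hρs, if_pos ⟨j, i, hi, rfl⟩, ih (by omega)]
    beta_reduce
    rw [hc i hi, (hkm j i hi).1, (hkm j i hi).2]
    push_cast; rfl

/-! ### The Fourier transform and completeness of weighted exponentials. -/

section FourierL2

open FourierTransform SchwartzMap

lemma integral_fourier_schwartz_mul {h : ℝ → ℂ} (hh : Integrable h) (ψ : 𝓢(ℝ, ℂ)) :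
    ∫ x, 𝓕 ψ x * h x = ∫ x, ψ x * 𝓕 h x := by
  have := VectorFourier.integral_fourierIntegral_smul_eq_flip (μ := volume) (ν := volume)
    (L := innerₗ ℝ) Real.continuous_fourierChar continuous_inner (f := ψ) (g := h)
    ψ.integrable hh
  simp only [flip_innerₗ, smul_eq_mul] at this
  exact this

lemma fourier_apply_eq_integral (h : ℝ → ℂ) (t : ℝ) : 𝓕 h t = ∫ x, expFreq (-t) x * h x := by
  rw [Real.fourier_real_eq]
  refine integral_congr_ae (Eventually.of_forall fun x => ?_)
  simp only [Circle.smul_def, Real.fourierChar_apply, smul_eq_mul, expFreq]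
  congr 4; ring

lemma continuous_fourier_of_integrable {h : ℝ → ℂ} (hh : Integrable h) : Continuous (𝓕 h) :=
  VectorFourier.fourierIntegral_continuous Real.continuous_fourierChar
    (innerSL ℝ).continuous₂ hh

lemma ae_eq_of_integral_schwartz_mul_eq {f g : ℝ → ℂ} (hf : LocallyIntegrable f)
    (hg : LocallyIntegrable g) (h : ∀ ψ : 𝓢(ℝ, ℂ), ∫ x, ψ x * f x = ∫ x, ψ x * g x) :
    f =ᵐ[volume] g := by
  refine ae_eq_of_integral_contDiff_smul_eq hf hg fun φ hφ hφc => ?_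
  have h1 : HasCompactSupport fun x => (φ x : ℂ) := hφc.comp_left (g := ((↑) : ℝ → ℂ)) (by simp)
  have h2 : ContDiff ℝ ∞ fun x => (φ x : ℂ) := Complex.ofRealCLM.contDiff.comp hφ
  simpa using h (h1.toSchwartzMap h2)

/-- An integrable function whose Fourier transform vanishes at the rationals vanishes a.e. -/
lemma ae_eq_zero_of_fourier_rat_eq_zero {h : ℝ → ℂ} (hh : Integrable h)
    (h0 : ∀ k : ℚ, 𝓕 h k = 0) : h =ᵐ[volume] 0 := by
  have h1 : 𝓕 h = 0 := Continuous.ext_on Rat.denseRange_cast (continuous_fourier_of_integrable hh)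
    continuous_const (by rintro _ ⟨k, rfl⟩; exact h0 k)
  refine ae_eq_of_integral_schwartz_mul_eq hh.locallyIntegrable (locallyIntegrable_const 0)
    fun ψ => ?_
  -- Every Schwartz function is a Fourier transform, so the multiplication formula tests `h` against
  -- all of them.
  have h2 := integral_fourier_schwartz_mul hh (𝓕⁻ ψ)
  rw [FourierTransform.fourier_fourierInv_eq, h1] at h2
  simpa using h2

/-- On `L¹ ∩ L²` the `L²` Fourier transform is given by the Fourier integral. -/
lemma coeFn_fourier_toLp {h : ℝ → ℂ} (h1 : Integrable h) (h2 : MemLp h 2 volume) :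
    (𝓕 (h2.toLp h) : Lp ℂ 2 (volume : Measure ℝ)) =ᵐ[volume] 𝓕 h := by
  refine ae_eq_of_integral_schwartz_mul_eq
    ((Lp.memLp _).locallyIntegrable (by norm_num))
    (continuous_fourier_of_integrable h1).locallyIntegrable fun ψ => ?_
  have h3 := congrArg (fun d => d ψ) (Lp.fourier_toTemperedDistribution_eq (h2.toLp h))
  simp only [TemperedDistribution.fourier_apply, Lp.toTemperedDistribution_apply,
    smul_eq_mul] at h3
  rw [← h3, ← integral_fourier_schwartz_mul h1]
  refine integral_congr_ae ?_
  filter_upwards [h2.coeFn_toLp] with x hx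
  rw [hx]

/-- The square root of the normalized Gaussian. -/
noncomputable def sqrtGauss (x : ℝ) : ℝ := Real.exp (-(Real.pi / 2) * x ^ 2)

lemma sqrtGauss_pos (x : ℝ) : 0 < sqrtGauss x := Real.exp_pos _

@[fun_prop] lemma continuous_sqrtGauss : Continuous sqrtGauss := by
  unfold sqrtGauss; fun_prop

lemma integrable_sqrtGauss : Integrable sqrtGauss :=
  integrable_exp_neg_mul_sq (by positivity)

lemma integrable_sqrtGauss_sq : Integrable fun x => sqrtGauss x ^ 2 := by
  have : (fun x => sqrtGauss x ^ 2) = fun x => Real.exp (-Real.pi * x ^ 2) := by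
    ext x; rw [sqrtGauss, ← Real.exp_nat_mul]; congr 1; push_cast; ring
  rw [this]
  exact integrable_exp_neg_mul_sq Real.pi_pos

lemma memLp_sqrtGauss : MemLp sqrtGauss 2 volume :=
  (memLp_two_iff_integrable_sq continuous_sqrtGauss.aestronglyMeasurable).2 integrable_sqrtGauss_sq

lemma memLp_mul_of_abs_le {w : ℝ → ℝ} (hw : Measurable w) (hwG : ∀ x, |w x| ≤ sqrtGauss x)
    (a : ℝ) : MemLp (fun x => (w x : ℂ) * expFreq a x) 2 volume := by
  refine memLp_sqrtGauss.mono (by fun_prop) (Eventually.of_forall fun x => ?_)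
  simpa [abs_of_pos (sqrtGauss_pos x)] using hwG x

lemma integrable_mul_of_abs_le {w : ℝ → ℝ} (hw : Measurable w) (hwG : ∀ x, |w x| ≤ sqrtGauss x)
    (a : ℝ) : Integrable (fun x => (w x : ℂ) * expFreq a x) := by
  refine integrable_sqrtGauss.mono (by fun_prop) (Eventually.of_forall fun x => ?_)
  simpa [abs_of_pos (sqrtGauss_pos x)] using hwG x

/-- The function `w(x) exp (2 π i a x)` as an element of `L²(ℝ)`. -/
noncomputable def weightedExp (w : ℝ → ℝ) (hw : Measurable w) (hwG : ∀ x, |w x| ≤ sqrtGauss x)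
    (a : ℝ) : Lp ℂ 2 (volume : Measure ℝ) :=
  (memLp_mul_of_abs_le hw hwG a).toLp _

lemma coeFn_weightedExp (w : ℝ → ℝ) (hw : Measurable w) (hwG : ∀ x, |w x| ≤ sqrtGauss x)
    (a : ℝ) : weightedExp w hw hwG a =ᵐ[volume] fun x => (w x : ℂ) * expFreq a x :=
  MemLp.coeFn_toLp _

lemma coeFn_sum_weightedExp (w : ℝ → ℝ) (hw : Measurable w) (hwG : ∀ x, |w x| ≤ sqrtGauss x)
    {ι : Type*} (s : Finset ι) (c : ι → ℂ) (a : ι → ℝ) :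
    (∑ i ∈ s, c i • weightedExp w hw hwG (a i) : Lp ℂ 2 (volume : Measure ℝ)) =ᵐ[volume]
      fun x => (w x : ℂ) * ∑ i ∈ s, c i * expFreq (a i) x := by
  classical
  induction s using Finset.induction_on with
  | empty =>
    exact Eventually.of_forall fun x => by simp
  | insert i s hi ih =>
    rw [Finset.sum_insert hi]
    filter_upwards [Lp.coeFn_add (c i • weightedExp w hw hwG (a i))
      (∑ i ∈ s, c i • weightedExp w hw hwG (a i)), ih,
      Lp.coeFn_smul (c i) (weightedExp w hw hwG (a i)),
      coeFn_weightedExp w hw hwG (a i)] with x h1 h2 h3 h4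
    rw [h1, Pi.add_apply, h2, h3, Pi.smul_apply, h4, smul_eq_mul, Finset.sum_insert hi]
    ring

lemma inner_weightedExp (w : ℝ → ℝ) (hw : Measurable w) (hwG : ∀ x, |w x| ≤ sqrtGauss x)
    (a : ℝ) (f : Lp ℂ 2 (volume : Measure ℝ)) :
    inner ℂ (weightedExp w hw hwG a) f = 𝓕 (fun x => (w x : ℂ) * f x) a := by
  rw [fourier_apply_eq_integral, L2.inner_def]
  refine integral_congr_ae ?_
  filter_upwards [coeFn_weightedExp w hw hwG a] with x hx
  rw [hx, RCLike.inner_apply, map_mul, conj_expFreq, Complex.conj_ofReal]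
  ring

/-- If `w` vanishes almost nowhere, the functions `w(x) exp (2 π i k x)`, `k` rational, are complete
in `L²(ℝ)`. -/
lemma dense_span_weightedExp (w : ℝ → ℝ) (hw : Measurable w) (hwG : ∀ x, |w x| ≤ sqrtGauss x)
    (hw0 : ∀ᵐ x, w x ≠ 0) :
    (Submodule.span ℂ (Set.range fun k : ℚ => weightedExp w hw hwG k)).topologicalClosure = ⊤ := by
  rw [Submodule.topologicalClosure_eq_top_iff, Submodule.eq_bot_iff]
  intro f hf
  rw [Submodule.mem_orthogonal] at hf
  have hmem : MemLp (fun x => (w x : ℂ)) 2 volume := by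
    simpa using memLp_mul_of_abs_le hw hwG 0
  have hint : Integrable fun x => (w x : ℂ) * f x := hmem.integrable_mul (Lp.memLp f)
  have h0 := ae_eq_zero_of_fourier_rat_eq_zero hint fun k => by
    rw [← inner_weightedExp w hw hwG]
    exact hf _ (Submodule.subset_span ⟨k, rfl⟩)
  rw [Lp.eq_zero_iff_ae_eq_zero]
  filter_upwards [h0, hw0] with x hx hx'
  simpa [hx'] using hx

/-- The square of the weight is `exp(-πx²)`, its own Fourier transform. The resulting Gaussian decay
in `a - b` supplies the row sums for Schur's test. -/
lemma inner_weightedExp_sqrtGauss (hw : Measurable sqrtGauss)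
    (hwG : ∀ x, |sqrtGauss x| ≤ sqrtGauss x) (a b : ℝ) :
    inner ℂ (weightedExp sqrtGauss hw hwG a) (weightedExp sqrtGauss hw hwG b) =
      (Real.exp (-Real.pi * (a - b) ^ 2) : ℂ) := by
  have h1 := congrFun (fourier_gaussian_pi (b := 1) (by simp)) (a - b)
  rw [inner_weightedExp, fourier_apply_eq_integral]
  rw [fourier_apply_eq_integral] at h1
  simp only [Complex.one_cpow, div_one, mul_one, one_mul] at h1
  push_cast at h1 ⊢
  rw [← h1]
  refine integral_congr_ae ?_
  filter_upwards [coeFn_weightedExp sqrtGauss hw hwG b] with x hx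
  have e1 : Complex.exp (-Real.pi * x ^ 2) = sqrtGauss x * sqrtGauss x := by
    rw [sqrtGauss, ← Complex.ofReal_mul, ← Real.exp_add, Complex.ofReal_exp]
    congr 1; push_cast; ring
  have e2 : expFreq (-(a - b)) x = expFreq (-a) x * expFreq b x := by
    rw [← expFreq_add]; congr 1; ring
  rw [hx, e1, e2]; ring

end FourierL2

/-! ### The Bessel inequality and unitary invariance. -/

section Bessel

variable {H : Type*} [NormedAddCommGroup H] [InnerProductSpace ℂ H] {ι : Type*}

/-- Schur's test for a Gram matrix. -/
lemma norm_sum_smul_sq_le_of_gram {v : ι → H} {K : ι → ι → ℝ} {C : ℝ}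
    (hK : ∀ i j, ‖inner ℂ (v i) (v j)‖ ≤ K i j) (hsymm : ∀ i j, K i j = K j i) (s : Finset ι)
    (hC : ∀ i, ∑ j ∈ s, K i j ≤ C) (c : ι → ℂ) :
    ‖∑ i ∈ s, c i • v i‖ ^ 2 ≤ C * ∑ i ∈ s, ‖c i‖ ^ 2 := by
  have hK0 : ∀ i j, 0 ≤ K i j := fun i j => (norm_nonneg _).trans (hK i j)
  have e : ((‖∑ i ∈ s, c i • v i‖ ^ 2 : ℝ) : ℂ) =
      ∑ i ∈ s, ∑ j ∈ s, (starRingEnd ℂ) (c i) * c j * inner ℂ (v i) (v j) := by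
    have h0 := inner_self_eq_norm_sq_to_K (𝕜 := ℂ) (∑ i ∈ s, c i • v i)
    rw [Complex.ofReal_pow]
    refine h0.symm.trans ?_
    rw [sum_inner]
    refine Finset.sum_congr rfl fun i _ => ?_
    rw [inner_sum]
    refine Finset.sum_congr rfl fun j _ => ?_
    rw [inner_smul_left, inner_smul_right]; ring
  have h1 : ‖∑ i ∈ s, c i • v i‖ ^ 2 ≤ ∑ i ∈ s, ∑ j ∈ s, ‖c i‖ * ‖c j‖ * K i j := by
    have := congrArg norm e
    rw [Complex.norm_real, Real.norm_of_nonneg (by positivity)] at this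
    rw [this]
    refine (norm_sum_le _ _).trans (Finset.sum_le_sum fun i _ =>
      (norm_sum_le _ _).trans (Finset.sum_le_sum fun j _ => ?_))
    rw [norm_mul, norm_mul, RCLike.norm_conj]
    gcongr
    exact hK i j
  have h2 : ∑ i ∈ s, ∑ j ∈ s, ‖c i‖ ^ 2 * K i j ≤ C * ∑ i ∈ s, ‖c i‖ ^ 2 := by
    rw [Finset.mul_sum]
    refine Finset.sum_le_sum fun i _ => ?_
    rw [← Finset.mul_sum, mul_comm]
    gcongr
    exact hC i
  have h3 : ∑ i ∈ s, ∑ j ∈ s, ‖c j‖ ^ 2 * K i j = ∑ i ∈ s, ∑ j ∈ s, ‖c i‖ ^ 2 * K i j := by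
    rw [Finset.sum_comm]
    exact Finset.sum_congr rfl fun i _ => Finset.sum_congr rfl fun j _ => by rw [hsymm]
  have h4 : ∑ i ∈ s, ∑ j ∈ s, ‖c i‖ * ‖c j‖ * K i j ≤
      ∑ i ∈ s, ∑ j ∈ s, (‖c i‖ ^ 2 * K i j / 2 + ‖c j‖ ^ 2 * K i j / 2) := by
    refine Finset.sum_le_sum fun i _ => Finset.sum_le_sum fun j _ => ?_
    nlinarith [hK0 i j, mul_nonneg (hK0 i j) (sq_nonneg (‖c i‖ - ‖c j‖))]
  simp only [Finset.sum_add_distrib, ← Finset.sum_div] at h4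
  rw [h3] at h4
  linarith

/-- The upper Riesz inequality implies the Bessel inequality. -/
lemma bessel_of_norm_sum_sq_le {v : ι → H} {C : ℝ} (hC0 : 0 ≤ C)
    (h : ∀ (s : Finset ι) (c : ι → ℂ), ‖∑ i ∈ s, c i • v i‖ ^ 2 ≤ C * ∑ i ∈ s, ‖c i‖ ^ 2) (f : H) :
    Summable (fun n => ‖inner ℂ f (v n)‖ ^ 2) ∧
      Real.sqrt (∑' n, ‖inner ℂ f (v n)‖ ^ 2) ≤ Real.sqrt C * ‖f‖ := by
  have key : ∀ s : Finset ι, ∑ i ∈ s, ‖inner ℂ f (v i)‖ ^ 2 ≤ C * ‖f‖ ^ 2 := by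
    intro s
    set S := ∑ i ∈ s, ‖inner ℂ f (v i)‖ ^ 2 with hS
    have hS0 : 0 ≤ S := Finset.sum_nonneg fun _ _ => by positivity
    -- Duality: `S = ⟨f, g⟩ ≤ ‖f‖ ‖g‖` and `‖g‖² ≤ C S` together give `S ≤ C ‖f‖²`.
    set g := ∑ i ∈ s, (starRingEnd ℂ) (inner ℂ f (v i)) • v i with hg
    have h1 : inner ℂ f g = (S : ℂ) := by
      rw [hg, inner_sum, hS]
      push_cast
      refine Finset.sum_congr rfl fun i _ => ?_
      rw [inner_smul_right, ← Complex.normSq_eq_conj_mul_self, Complex.normSq_eq_norm_sq]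
      push_cast; rfl
    have h2 : S ≤ ‖f‖ * ‖g‖ := by
      have := norm_inner_le_norm (𝕜 := ℂ) f g
      rwa [h1, Complex.norm_real, Real.norm_of_nonneg hS0] at this
    have h3 : ‖g‖ ^ 2 ≤ C * S := by
      have := h s fun i => (starRingEnd ℂ) (inner ℂ f (v i))
      simpa only [RCLike.norm_conj] using this
    rcases hS0.eq_or_lt with h0 | h0
    · rw [← h0]; positivity
    · have h4 : S * S ≤ C * ‖f‖ ^ 2 * S := by
        calc S * S ≤ (‖f‖ * ‖g‖) * (‖f‖ * ‖g‖) := by gcongr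
          _ = ‖f‖ ^ 2 * ‖g‖ ^ 2 := by ring
          _ ≤ ‖f‖ ^ 2 * (C * S) := by gcongr
          _ = _ := by ring
      exact le_of_mul_le_mul_right h4 h0
  have hs : Summable (fun n => ‖inner ℂ f (v n)‖ ^ 2) :=
    summable_of_sum_le (fun _ => by positivity) key
  refine ⟨hs, ?_⟩
  rw [Real.sqrt_le_left (by positivity), mul_pow, Real.sq_sqrt hC0]
  exact hs.tsum_le_of_sum_le key

/-- Being a (QF)-system is invariant under unitary maps. -/
lemma IsQFSystem.map {H' : Type*} [NormedAddCommGroup H'] [InnerProductSpace ℂ H'] {v : ι → H}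
    (hv : IsQFSystem v) (U : H ≃ₗᵢ[ℂ] H') : IsQFSystem fun i => U (v i) where
  approx q hq := by
    obtain ⟨C, hC⟩ := hv.approx q hq
    refine ⟨C, fun f η hη => ?_⟩
    obtain ⟨c, h1, h2⟩ := hC (U.symm f) η hη
    refine ⟨c, ?_, by simpa using h2⟩
    rw [← U.norm_map, map_sub, map_sum] at h1
    simpa using h1
  bessel := by
    obtain ⟨C, hC⟩ := hv.bessel
    refine ⟨C, fun f => ?_⟩
    have := hC (U.symm f)
    have e : ∀ i, inner ℂ (U.symm f) (v i) = inner ℂ f (U (v i)) := fun i => by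
      rw [← U.inner_map_map, U.apply_symm_apply]
    simpa [e] using this

end Bessel

lemma summable_exp_neg_pi_int_sq : Summable fun k : ℤ => Real.exp (-Real.pi * (k : ℝ) ^ 2) := by
  have h : Summable fun k : ℕ => Real.exp (-Real.pi * (k : ℝ) ^ 2) := by
    refine Summable.of_nonneg_of_le (fun _ => (Real.exp_pos _).le) (fun k => ?_)
      (Real.summable_exp_neg_nat)
    apply Real.exp_le_exp.2
    have h1 : (k : ℝ) ≤ (k : ℝ) ^ 2 := by
      exact_mod_cast Nat.le_self_pow two_ne_zero k
    nlinarith [Real.pi_gt_three, sq_nonneg (k : ℝ)]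
  exact Summable.of_nat_of_neg (by simpa using h) (by simpa using h)

lemma natCast_sub_le_of_one_le_step {lam : ℕ → ℝ} (hl : ∀ n, lam n + 1 ≤ lam (n + 1)) {m n : ℕ}
    (h : m ≤ n) : (n : ℝ) - m ≤ lam n - lam m := by
  induction n, h using Nat.le_induction with
  | base => simp
  | succ n _ ih => push_cast; linarith [hl n]

lemma abs_natCast_sub_le_of_one_le_step {lam : ℕ → ℝ} (hl : ∀ n, lam n + 1 ≤ lam (n + 1))
    (m n : ℕ) : |(n : ℝ) - m| ≤ |lam n - lam m| := by
  rcases le_total m n with h | h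
  · have h1 : (0 : ℝ) ≤ (n : ℝ) - m := sub_nonneg.2 (by exact_mod_cast h)
    rw [abs_of_nonneg h1]
    exact (natCast_sub_le_of_one_le_step hl h).trans (le_abs_self _)
  · have h1 : (0 : ℝ) ≤ (m : ℝ) - n := sub_nonneg.2 (by exact_mod_cast h)
    rw [abs_sub_comm, abs_of_nonneg h1, abs_sub_comm]
    exact (natCast_sub_le_of_one_le_step hl h).trans (le_abs_self _)

/-- Bessel inequality for weighted exponentials with separated frequencies. -/
lemma bessel_weightedExp (w : ℝ → ℝ) (hw : Measurable w) (hwG : ∀ x, |w x| ≤ sqrtGauss x)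
    {lam : ℕ → ℝ} (hl : ∀ n, lam n + 1 ≤ lam (n + 1)) :
    ∃ C' : ℝ, ∀ f : Lp ℂ 2 (volume : Measure ℝ),
      Summable (fun n => ‖inner ℂ f (weightedExp w hw hwG (lam n))‖ ^ 2) ∧
      Real.sqrt (∑' n, ‖inner ℂ f (weightedExp w hw hwG (lam n))‖ ^ 2) ≤ C' * ‖f‖ := by
  have hgm : Measurable sqrtGauss := continuous_sqrtGauss.measurable
  have hgG : ∀ x, |sqrtGauss x| ≤ sqrtGauss x := fun x => (abs_of_pos (sqrtGauss_pos x)).le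
  set C := ∑' k : ℤ, Real.exp (-Real.pi * (k : ℝ) ^ 2)
  refine ⟨Real.sqrt C, bessel_of_norm_sum_sq_le (tsum_nonneg fun _ => (Real.exp_pos _).le)
    fun s c => ?_⟩
  -- Pointwise domination reduces an arbitrary weight to the Gaussian one, whose Gram matrix is
  -- explicit.
  have h1 : ‖∑ i ∈ s, c i • weightedExp w hw hwG (lam i)‖ ≤
      ‖∑ i ∈ s, c i • weightedExp sqrtGauss hgm hgG (lam i)‖ := by
    apply Lp.norm_le_norm_of_ae_le
    filter_upwards [coeFn_sum_weightedExp w hw hwG s c lam,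
      coeFn_sum_weightedExp sqrtGauss hgm hgG s c lam] with x h2 h3
    rw [h2, h3, norm_mul, norm_mul]
    gcongr
    simpa [abs_of_pos (sqrtGauss_pos x)] using hwG x
  refine (pow_le_pow_left₀ (norm_nonneg _) h1 2).trans ?_
  refine norm_sum_smul_sq_le_of_gram
    (K := fun i j => Real.exp (-Real.pi * (lam i - lam j) ^ 2)) (fun i j => ?_) (fun i j => ?_) s
    (fun i => ?_) c
  · rw [inner_weightedExp_sqrtGauss, Complex.norm_real, Real.norm_of_nonneg (Real.exp_pos _).le]
  · congr 2; ring
  · calc ∑ j ∈ s, Real.exp (-Real.pi * (lam i - lam j) ^ 2)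
        ≤ ∑ j ∈ s, Real.exp (-Real.pi * (((i : ℤ) - j : ℤ) : ℝ) ^ 2) := by
          refine Finset.sum_le_sum fun j _ => Real.exp_le_exp.2 ?_
          have := sq_le_sq.2 (abs_natCast_sub_le_of_one_le_step hl j i)
          push_cast
          nlinarith [Real.pi_pos]
      _ = ∑ k ∈ s.image fun j : ℕ => ((i : ℤ) - j : ℤ), Real.exp (-Real.pi * (k : ℝ) ^ 2) := by
          rw [Finset.sum_image]
          intro a _ b _ h
          simpa using h
      _ ≤ C := summable_exp_neg_pi_int_sq.sum_le_tsum _ fun _ _ => (Real.exp_pos _).le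

/-! ### Entire generators. -/

/-- The translates of a function with entire extension realize the Fourier transforms of the
weighted exponentials. -/
lemma exists_entire_translates (w : ℝ → ℝ) (hw : Measurable w) (hw0 : ∀ x, 0 ≤ w x)
    (hwG : ∀ x, |w x| ≤ sqrtGauss x) :
    ∃ (g : ℝ → ℂ) (hg : MemLp g 2 volume),
      (∀ a, translateLp g hg a = Lp.fourierTransformₗᵢ ℝ ℂ (weightedExp w hw hwG a)) ∧
      ∃ G : ℂ → ℂ, Differentiable ℂ G ∧ ∀ t : ℝ, g t = G t := by
  open FourierTransform in
  set g : ℝ → ℂ := 𝓕 fun x => (w x : ℂ) with hgdef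
  have hF : ∀ a, (𝓕 (weightedExp w hw hwG a) : Lp ℂ 2 (volume : Measure ℝ)) =ᵐ[volume]
      fun t => g (t - a) := fun a => by
    refine (coeFn_fourier_toLp (integrable_mul_of_abs_le hw hwG a)
      (memLp_mul_of_abs_le hw hwG a)).trans (Eventually.of_forall fun t => ?_)
    rw [hgdef]
    simp only [fourier_apply_eq_integral]
    refine integral_congr_ae (Eventually.of_forall fun x => ?_)
    have e : expFreq (-(t - a)) x = expFreq (-t) x * expFreq a x := by
      rw [← expFreq_add]; congr 1; ring
    simp only [e]; ring
  have hg : MemLp g 2 volume := by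
    have := (memLp_congr_ae (hF 0)).1 (Lp.memLp _)
    simpa using this
  refine ⟨g, hg, fun a => ?_, ?_⟩
  · apply Lp.ext
    exact (MemLp.coeFn_toLp _).trans (hF a).symm
  -- The Gaussian bound gives the measure `w dx` all exponential moments, so its complex moment
  -- generating function is entire; `g t` is its value at `-2πit`.
  · set μ : Measure ℝ := volume.withDensity fun x => ENNReal.ofReal (w x)
    have hset : ProbabilityTheory.integrableExpSet id μ = Set.univ := by
      rw [Set.eq_univ_iff_forall]
      intro s
      change Integrable (fun x => Real.exp (s * id x)) μ
      rw [integrable_withDensity_iff_integrable_smul' hw.ennreal_ofReal (by simp)]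
      refine Integrable.mono' (g := fun x => Real.exp (s ^ 2 / Real.pi) *
        Real.exp (-(Real.pi / 4) * x ^ 2))
        ((integrable_exp_neg_mul_sq (by positivity)).const_mul _) (by fun_prop)
        (Eventually.of_forall fun x => ?_)
      rw [ENNReal.toReal_ofReal (hw0 x), smul_eq_mul, Real.norm_of_nonneg
        (mul_nonneg (hw0 x) (Real.exp_pos _).le), ← Real.exp_add]
      refine (mul_le_mul_of_nonneg_right ((le_abs_self _).trans (hwG x))
        (Real.exp_pos _).le).trans ?_
      rw [sqrtGauss, ← Real.exp_add]
      apply Real.exp_le_exp.2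
      have h1 : 0 ≤ (s - Real.pi / 2 * x) ^ 2 / Real.pi := by positivity
      have h2 : (s - Real.pi / 2 * x) ^ 2 / Real.pi =
          s ^ 2 / Real.pi - s * x + Real.pi / 4 * x ^ 2 := by field_simp; ring
      simp only [id]
      linarith
    have hdiff : Differentiable ℂ (ProbabilityTheory.complexMGF id μ) := by
      have := ProbabilityTheory.differentiableOn_complexMGF (X := id) (μ := μ)
      rw [hset] at this
      simpa [differentiableOn_univ] using this
    refine ⟨fun z => ProbabilityTheory.complexMGF id μ (-(2 * Real.pi * Complex.I) * z),
      hdiff.comp (by fun_prop), fun t => ?_⟩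
    beta_reduce
    rw [hgdef, fourier_apply_eq_integral, 
      ProbabilityTheory.complexMGF.eq_def,
      integral_withDensity_eq_integral_toReal_smul hw.ennreal_ofReal (by simp)]
    refine integral_congr_ae (Eventually.of_forall fun x => ?_)
    simp only [ENNReal.toReal_ofReal (hw0 x), Complex.real_smul, id, expFreq]
    rw [mul_comm]; congr 2; push_cast; ring

/-! ### From convergence in measure to a weight. -/

/-- A common weight for a sequence of functions converging to zero in measure fast enough. -/
lemma exists_weight {Δ : ℕ → ℝ → ℝ} (hΔc : ∀ j, Continuous (Δ j)) (hΔ0 : ∀ j x, 0 ≤ Δ j x)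
    (hΔ : ∀ j : ℕ, ∫ x in (-j : ℝ)..j, min 1 ((j + 1) * Δ j x) ≤ (1 / 2) ^ j) :
    ∃ w : ℝ → ℝ, Measurable w ∧ (∀ x, 0 ≤ w x) ∧ (∀ x, |w x| ≤ sqrtGauss x) ∧
      (∀ᵐ x, w x ≠ 0) ∧ ∀ (j : ℕ) x, w x * ((j + 1) * Δ j x) ≤ sqrtGauss x := by
  -- The weight is `sqrtGauss / (1 + S)`, which vanishes exactly where `S` is infinite. A
  -- Borel–Cantelli argument shows that this set is null.
  let S : ℝ → ENNReal := fun x => ⨆ j : ℕ, ENNReal.ofReal ((j + 1) * Δ j x)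
  have hSm : Measurable S := Measurable.iSup fun j => by fun_prop
  have hle : ∀ x, ((1 + S x)⁻¹).toReal ≤ 1 := fun x => by
    refine ENNReal.toReal_le_of_le_ofReal zero_le_one ?_
    simp
  refine ⟨fun x => sqrtGauss x * ((1 + S x)⁻¹).toReal, ?_, fun x => ?_, fun x => ?_, ?_,
    fun j x => ?_⟩
  · exact continuous_sqrtGauss.measurable.mul ((measurable_const.add hSm).inv.ennreal_toReal)
  · exact mul_nonneg (sqrtGauss_pos x).le ENNReal.toReal_nonneg
  · rw [abs_of_nonneg (mul_nonneg (sqrtGauss_pos x).le ENNReal.toReal_nonneg)]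
    exact mul_le_of_le_one_right (sqrtGauss_pos x).le (hle x)
  · let F : ℕ → ℝ → ENNReal := fun j => (Set.Ioc (-j : ℝ) j).indicator fun x =>
      ENNReal.ofReal (min 1 ((j + 1) * Δ j x))
    have hFm : ∀ j, Measurable (F j) := fun j => by
      refine Measurable.indicator ?_ measurableSet_Ioc
      have := (hΔc j).measurable
      fun_prop
    have hFint : ∀ j, ∫⁻ x, F j x ≤ ENNReal.ofReal ((1 / 2) ^ j) := fun j => by
      have hj : (-j : ℝ) ≤ j := by linarith [Nat.cast_nonneg (α := ℝ) j]
      have hc : Continuous fun x => min 1 ((j + 1) * Δ j x) := by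
        have := hΔc j
        fun_prop
      have h0 : ∀ x, 0 ≤ min 1 ((j + 1) * Δ j x) := fun x =>
        le_min zero_le_one (mul_nonneg (by positivity) (hΔ0 j x))
      have h := hΔ j
      rw [intervalIntegral.integral_of_le hj] at h
      rw [lintegral_indicator measurableSet_Ioc, ← ofReal_integral_eq_lintegral_ofReal
        (hc.integrableOn_Icc.mono_set Set.Ioc_subset_Icc_self)
        (Eventually.of_forall h0)]
      exact ENNReal.ofReal_le_ofReal h
    have hsum : ∫⁻ x, ∑' j, F j x ≠ ⊤ := by
      rw [lintegral_tsum fun j => (hFm j).aemeasurable]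
      refine ne_top_of_le_ne_top ?_ (ENNReal.tsum_le_tsum hFint)
      rw [← ENNReal.ofReal_tsum_of_nonneg (fun _ => by positivity)
        (summable_geometric_of_lt_one (by norm_num) (by norm_num))]
      exact ENNReal.ofReal_ne_top
    filter_upwards [ae_lt_top (Measurable.tsum hFm) hsum] with x hx
    -- The terms of a convergent series are eventually below `1`. Once `j > |x|`, this forces `(j +
    -- 1) Δ j x < 1`, so the supremum involves only finitely many larger values.
    have hSx : S x ≠ ⊤ := by
      have h1 := (tendsto_order.1 (ENNReal.tendsto_atTop_zero_of_tsum_ne_top hx.ne)).2 1 one_pos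
      obtain ⟨J, hJ⟩ := eventually_atTop.1 (h1.and
        (tendsto_natCast_atTop_atTop.eventually_gt_atTop |x|))
      have h2 : ∀ j ≥ J, ENNReal.ofReal ((j + 1) * Δ j x) ≤ 1 := fun j hj => by
        obtain ⟨h3, h4⟩ := hJ j hj
        have hmem : x ∈ Set.Ioc (-j : ℝ) j :=
          ⟨(abs_lt.1 h4).1, (abs_lt.1 h4).2.le⟩
        simp only [F, Set.indicator_of_mem hmem] at h3
        rw [ENNReal.ofReal_lt_one, min_lt_iff] at h3
        rw [ENNReal.ofReal_le_one]
        rcases h3 with h3 | h3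
        · exact absurd h3 (lt_irrefl _)
        · exact h3.le
      refine ne_top_of_le_ne_top (b := 1 + ∑ j ∈ Finset.range J,
        ENNReal.ofReal ((j + 1) * Δ j x)) (by simp [ENNReal.sum_eq_top]) (iSup_le fun j => ?_)
      rcases lt_or_ge j J with h | h
      · exact (Finset.single_le_sum (f := fun j : ℕ => ENNReal.ofReal ((j + 1) * Δ j x))
          (fun _ _ => zero_le) (Finset.mem_range.2 h)).trans le_add_self
      · exact (h2 j h).trans le_self_add
    refine mul_ne_zero (sqrtGauss_pos x).ne' (ENNReal.toReal_ne_zero.2 ⟨?_, ?_⟩)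
    · exact ENNReal.inv_ne_zero.2 (ENNReal.add_ne_top.2 ⟨ENNReal.one_ne_top, hSx⟩)
    · simp
  · have h1 : ((1 + S x)⁻¹).toReal * ((j + 1) * Δ j x) ≤ 1 := by
      have h0 : 0 ≤ (j + 1) * Δ j x := mul_nonneg (by positivity) (hΔ0 j x)
      rw [← ENNReal.toReal_ofReal h0, ← ENNReal.toReal_mul]
      refine ENNReal.toReal_le_of_le_ofReal zero_le_one ?_
      rw [ENNReal.ofReal_one]
      calc (1 + S x)⁻¹ * ENNReal.ofReal ((j + 1) * Δ j x) ≤ (1 + S x)⁻¹ * (1 + S x) := by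
            gcongr
            exact (le_iSup (fun j : ℕ => ENNReal.ofReal ((j + 1) * Δ j x)) j).trans le_add_self
        _ ≤ 1 := ENNReal.inv_mul_le_one _
    rw [mul_assoc]
    exact mul_le_of_le_one_right (sqrtGauss_pos x).le h1

/-! ### The approximation property. -/

/-- Block `j` is controlled in exponent `2 + 1/(j+1)`; this passes the bound to any fixed `q > 2`
once `j` is large. -/
lemma rpow_le_rpow_of_rpow_le_one {x p q : ℝ} (hx : 0 ≤ x) (hp : 0 < p) (hpq : p ≤ q)
    (h : x ^ p ≤ 1) : x ^ q ≤ x ^ p := by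
  have hx1 : x ≤ 1 := by
    by_contra hx1
    push Not at hx1
    exact absurd h (not_le.2 (Real.one_lt_rpow hx1 hp))
  exact Real.rpow_le_rpow_of_exponent_ge' hx hx1 hp.le hpq

/-- A sufficient condition for weighted exponentials to form a (QF)-system: every exponential of
rational frequency is approximated by infinitely many blocks with small coefficients. -/
lemma isQFSystem_weightedExp {w : ℝ → ℝ} (hw : Measurable w) (hwG : ∀ x, |w x| ≤ sqrtGauss x)
    (hw0 : ∀ᵐ x, w x ≠ 0) {lam : ℕ → ℝ} (hl : ∀ n, lam n + 1 ≤ lam (n + 1)) {N D : ℕ → ℕ}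
    (hND : ∀ j, N j + D j ≤ N (j + 1)) {k : ℕ → ℚ} (hk : ∀ (r : ℚ) (J : ℕ), ∃ j ≥ J, k j = r)
    {c : ℕ → ℕ → ℂ}
    (hc : ∀ j : ℕ, ∑ i ∈ Finset.range (D j), ‖c j i‖ ^ (2 + 1 / ((j : ℝ) + 1)) ≤ (1 / 2) ^ j)
    (happ : ∀ (j : ℕ) x, |w x| * ((j + 1) * ‖expFreq (k j) x -
      ∑ i ∈ Finset.range (D j), c j i * expFreq (lam (N j + i)) x‖) ≤ sqrtGauss x) :
    IsQFSystem fun n => weightedExp w hw hwG (lam n) := by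
  -- The constant `1` suffices for every `q`, because late blocks make the coefficients arbitrarily
  -- small. The case `f = 0` is separate: it leaves no room for nonzero coefficients.
  refine ⟨fun q hq => ⟨1, fun f η hη => ?_⟩, bessel_weightedExp w hw hwG hl⟩
  rw [one_mul]
  by_cases hf : f = 0
  · exact ⟨0, by simpa [hf] using hη, by simp [hf, (by linarith : q ≠ 0)]⟩
  have hf0 : 0 < ‖f‖ := norm_pos_iff.2 hf
  set v := weightedExp w hw hwG with hv
  set Γ := weightedExp sqrtGauss continuous_sqrtGauss.measurable
    (fun x => (abs_of_pos (sqrtGauss_pos x)).le) 0 with hΓ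
  have hblock : ∀ j : ℕ, ‖v (k j) - ∑ i ∈ Finset.range (D j), c j i • v (lam (N j + i))‖ ≤
      1 / ((j : ℝ) + 1) * ‖Γ‖ := fun j => by
    apply Lp.norm_le_mul_norm_of_ae_le_mul
    filter_upwards [Lp.coeFn_sub (v (k j)) (∑ i ∈ Finset.range (D j), c j i • v (lam (N j + i))),
      coeFn_weightedExp w hw hwG (k j),
      coeFn_sum_weightedExp w hw hwG (Finset.range (D j)) (c j) fun i => lam (N j + i),
      coeFn_weightedExp sqrtGauss continuous_sqrtGauss.measurable
        (fun x => (abs_of_pos (sqrtGauss_pos x)).le) 0] with x h1 h2 h3 h4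
    rw [h1, Pi.sub_apply, h2, h3, h4, ← mul_sub, norm_mul, norm_mul, norm_expFreq, mul_one,
      Complex.norm_real, Complex.norm_real, Real.norm_eq_abs, Real.norm_eq_abs,
      abs_of_pos (sqrtGauss_pos x), one_div, ← div_eq_inv_mul, le_div_iff₀ (by positivity)]
    have := happ j x
    linarith
  have hmem : f ∈ (Submodule.span ℂ (Set.range fun r : ℚ => v r)).topologicalClosure := by
    rw [dense_span_weightedExp w hw hwG hw0]; trivial
  obtain ⟨s, hs, hfs⟩ := Metric.mem_closure_iff.1 hmem (η / 2) (by positivity)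
  obtain ⟨a, rfl⟩ := Finsupp.mem_span_range_iff_exists_finsupp.1 hs
  rw [dist_eq_norm] at hfs
  obtain ⟨J, hJ1, hJ2, hJ3⟩ : ∃ J : ℕ, 1 / ((J : ℝ) + 1) * ((∑ r ∈ a.support, ‖a r‖) * ‖Γ‖) <
      η / 2 ∧ 1 / ((J : ℝ) + 1) < q - 2 ∧ (∑ r ∈ a.support, ‖a r‖ ^ q) * (1 / 2) ^ J < ‖f‖ ^ q := by
    have l1 := (tendsto_one_div_add_atTop_nhds_zero_nat (𝕜 := ℝ)).mul_const
      ((∑ r ∈ a.support, ‖a r‖) * ‖Γ‖)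
    have l3 := (tendsto_pow_atTop_nhds_zero_of_lt_one (r := (1 / 2 : ℝ)) (by norm_num)
      (by norm_num)).const_mul (∑ r ∈ a.support, ‖a r‖ ^ q)
    rw [zero_mul] at l1
    rw [mul_zero] at l3
    exact (((tendsto_order.1 l1).2 _ (by positivity)).and
      (((tendsto_order.1 tendsto_one_div_add_atTop_nhds_zero_nat).2 _ (by linarith)).and
      ((tendsto_order.1 l3).2 _ (by positivity)))).exists
  -- Each rational frequency in the approximant gets its own block beyond `J`; distinct frequencies
  -- get disjoint index sets, so the `ℓ^q` sums add.
  choose j hjJ hjk using fun r : ℚ => hk r J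
  have hjinj : Function.Injective j := fun r r' h => by rw [← hjk r, ← hjk r', h]
  have hmono : Monotone N := monotone_nat_of_le_succ fun i => le_self_add.trans (hND i)
  have hinj : Set.InjOn (fun u : (_ : ℚ) × ℕ => N (j u.1) + u.2)
      (a.support.sigma fun r => Finset.range (D (j r))) := by
    rintro ⟨r, i⟩ hu ⟨r', i'⟩ hu' h
    simp only [Finset.coe_sigma, Set.mem_sigma_iff, Finset.mem_coe, Finset.mem_range] at hu hu' h
    rcases lt_trichotomy (j r) (j r') with h1 | h1 | h1
    · have h2 := hND (j r)
      have h3 : N (j r + 1) ≤ N (j r') := hmono h1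
      omega
    · obtain rfl := hjinj h1
      simpa using h
    · have h2 := hND (j r')
      have h3 : N (j r' + 1) ≤ N (j r) := hmono h1
      omega
  obtain ⟨b, hb⟩ := exists_finsupp_of_injOn (a.support.sigma fun r => Finset.range (D (j r)))
    (fun u => a u.1 * c (j u.1) u.2) hinj
  have hb' : ∀ i, 1 / ((j i : ℝ) + 1) ≤ 1 / ((J : ℝ) + 1) := fun i => by
    have : (J : ℝ) ≤ j i := by exact_mod_cast hjJ i
    gcongr
  refine ⟨b, ?_, ?_⟩
  · have e : ∑ n ∈ b.support, b n • v (lam n) = ∑ r ∈ a.support, a r •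
        ∑ i ∈ Finset.range (D (j r)), c (j r) i • v (lam (N (j r) + i)) := by
      have := hb (γ := Lp ℂ 2 (volume : Measure ℝ)) (fun n z => z • v (lam n))
        fun n => zero_smul _ _
      rw [Finsupp.sum] at this
      rw [this, Finset.sum_sigma]
      refine Finset.sum_congr rfl fun r _ => ?_
      rw [Finset.smul_sum]
      exact Finset.sum_congr rfl fun i _ => mul_smul _ _ _
    rw [e]
    have e2 : f - ∑ r ∈ a.support, a r •
        ∑ i ∈ Finset.range (D (j r)), c (j r) i • v (lam (N (j r) + i)) =
        (f - a.sum fun i z => z • v i) + ∑ r ∈ a.support, a r •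
          (v r - ∑ i ∈ Finset.range (D (j r)), c (j r) i • v (lam (N (j r) + i))) := by
      simp only [smul_sub, Finset.sum_sub_distrib, Finsupp.sum]
      abel
    rw [e2]
    refine (norm_add_le _ _).trans_lt ?_
    have h1 : ‖∑ r ∈ a.support, a r •
          (v r - ∑ i ∈ Finset.range (D (j r)), c (j r) i • v (lam (N (j r) + i)))‖ ≤
        1 / ((J : ℝ) + 1) * ((∑ r ∈ a.support, ‖a r‖) * ‖Γ‖) := by
      rw [Finset.sum_mul, Finset.mul_sum]
      refine (norm_sum_le _ _).trans (Finset.sum_le_sum fun r _ => ?_)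
      rw [norm_smul]
      have h2 := hblock (j r)
      rw [hjk r] at h2
      calc _ ≤ ‖a r‖ * (1 / ((j r : ℝ) + 1) * ‖Γ‖) := by gcongr
        _ ≤ ‖a r‖ * (1 / ((J : ℝ) + 1) * ‖Γ‖) := by gcongr ‖a r‖ * (?_ * ‖Γ‖); exact hb' r
        _ = _ := by ring
    linarith
  · have hq0 : q ≠ 0 := by linarith
    have e := hb (fun _ z => ‖z‖ ^ q) fun n => by simp [hq0]
    rw [Finsupp.sum, Finset.sum_sigma] at e
    have h1 : ∑ n ∈ b.support, ‖b n‖ ^ q ≤ ‖f‖ ^ q := by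
      rw [e]
      refine le_trans ?_ hJ3.le
      rw [Finset.sum_mul]
      refine Finset.sum_le_sum fun r _ => ?_
      simp only [norm_mul, Real.mul_rpow (norm_nonneg _) (norm_nonneg _)]
      rw [← Finset.mul_sum]
      refine mul_le_mul_of_nonneg_left ?_ (by positivity)
      have hc1 := hc (j r)
      have h2 : (1 / 2 : ℝ) ^ j r ≤ (1 / 2) ^ J :=
        pow_le_pow_of_le_one (by norm_num) (by norm_num) (hjJ r)
      refine le_trans (Finset.sum_le_sum fun i hi => ?_) (hc1.trans h2)
      refine rpow_le_rpow_of_rpow_le_one (norm_nonneg _) (by positivity)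
        (by linarith [hb' r]) ?_
      refine (Finset.single_le_sum (f := fun i => ‖c (j r) i‖ ^ (2 + 1 / ((j r : ℝ) + 1)))
        (fun _ _ => by positivity) hi).trans (hc1.trans ?_)
      exact pow_le_one₀ (by norm_num) (by norm_num)
    calc _ ≤ (‖f‖ ^ q) ^ (1 / q) := Real.rpow_le_rpow
          (Finset.sum_nonneg fun _ _ => by positivity) h1 (by positivity)
      _ = ‖f‖ := by rw [← Real.rpow_mul hf0.le, mul_one_div_cancel hq0, Real.rpow_one]

/-- The index codes a pair of naturals, the first of which determines the rational; a code is at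
least its second entry, so every rational recurs arbitrarily late. -/
lemma exists_frequently_rat : ∃ k : ℕ → ℚ, ∀ (r : ℚ) (J : ℕ), ∃ j ≥ J, k j = r :=
  ⟨fun j => (Denumerable.eqv ℚ).symm j.unpair.1, fun r J =>
    ⟨Nat.pair (Denumerable.eqv ℚ r) J, Nat.right_le_pair _ _, by
      beta_reduce
      rw [Nat.unpair_pair]
      exact (Denumerable.eqv ℚ).symm_apply_apply r⟩⟩

/-! ### Assembly. -/

lemma exists_quasiLacunary_qfSystem {ε : ℕ → ℝ} (hε : ∀ n, 0 < ε n)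
    (hε0 : Tendsto ε atTop (𝓝 0)) :
    ∃ (lam : ℕ → ℝ) (g : ℝ → ℂ) (hg : MemLp g 2 volume),
      UniformlyDiscrete lam ∧
      (∀ n, 0 < lam n) ∧
      (∀ n, lam (n + 1) / lam n > 1 + ε n) ∧
      IsQFSystem (fun n => translateLp g hg (lam n)) ∧
      ContDiff ℝ ∞ g ∧
      ∃ G : ℂ → ℂ, Differentiable ℂ G ∧ ∀ t : ℝ, g t = G (t : ℂ) := by
  obtain ⟨k, hk⟩ := exists_frequently_rat
  -- The denominator pays for the interval length `2j` and the factor `j + 1` in the hypothesis of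
  -- `exists_weight`.
  have hδ : ∀ j : ℕ, (0 : ℝ) < (1 / 2) ^ j / (2 * (j + 1) ^ 2) := fun j => by positivity
  choose D c hcq hcint using fun j : ℕ => exists_small_coeff_approx_one
    (q := 2 + 1 / ((j : ℝ) + 1)) (lt_add_of_pos_right _ (by positivity)) (hδ j)
  obtain ⟨lam, N, R, hpos, hstep, hratio, hR, hND, hlam⟩ :=
    exists_lacunary_blocks hε hε0 D fun j => (k j : ℝ)
  set P : ℕ → ℝ → ℂ := fun j x => 1 - ∑ n ∈ Finset.range (D j), c j n * expFreq (n + 1) x with hP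
  have hPc : ∀ j, Continuous (P j) := fun j => by fun_prop
  have hΔ : ∀ (j : ℕ) x, ‖expFreq (k j) x -
      ∑ i ∈ Finset.range (D j), c j i * expFreq (lam (N j + i)) x‖ = ‖P j (R j * x)‖ := by
    intro j x
    have e : expFreq (k j) x - ∑ i ∈ Finset.range (D j), c j i * expFreq (lam (N j + i)) x =
        expFreq (k j) x * P j (R j * x) := by
      rw [hP, mul_sub, mul_one, Finset.mul_sum]
      congr 1
      refine Finset.sum_congr rfl fun i hi => ?_
      rw [hlam j i (Finset.mem_range.1 hi), expFreq_add, mul_comm (R j : ℝ), expFreq_mul]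
      ring
    rw [e, norm_mul, norm_expFreq, one_mul]
  obtain ⟨w, hwm, hw0, hwG, hwne, hwΔ⟩ := exists_weight (Δ := fun j x => ‖P j (R j * x)‖)
    (fun j => by have := hPc j; fun_prop) (fun _ _ => norm_nonneg _) fun j => by
      have hper : Function.Periodic (fun x => min 1 ‖P j x‖) 1 := fun x => by
        have : ∀ n : ℕ, expFreq (n + 1) (x + 1) = expFreq (n + 1) x := fun n => by
          exact_mod_cast expFreq_periodic (n + 1) x
        simp only [hP, this]
      have hPj := hPc j
      have h1 := intervalIntegral_comp_nat_mul_of_periodic (by fun_prop) hper (hR j) (-j) j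
      push_cast at h1
      calc _ ≤ ∫ x in (-j : ℝ)..j, ((j : ℝ) + 1) * min 1 ‖P j (R j * x)‖ := by
            apply intervalIntegral.integral_mono_on (by linarith [Nat.cast_nonneg (α := ℝ) j])
            · exact Continuous.intervalIntegrable (by fun_prop) _ _
            · exact Continuous.intervalIntegrable (by fun_prop) _ _
            intro x _
            rw [mul_min_of_nonneg _ _ (by positivity)]
            gcongr
            linarith [Nat.cast_nonneg (α := ℝ) j]
        _ ≤ ((j : ℝ) + 1) * ((j - -j) * ((1 / 2) ^ j / (2 * (j + 1) ^ 2))) := by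
            rw [intervalIntegral.integral_const_mul, h1]
            have : (0 : ℝ) ≤ j - -j := by linarith [Nat.cast_nonneg (α := ℝ) j]
            gcongr
            exact hcint j
        _ = (1 / 2) ^ j * (j / (j + 1)) := by field_simp; ring
        _ ≤ (1 / 2) ^ j := by
            refine mul_le_of_le_one_right (by positivity) ?_
            rw [div_le_one (by positivity)]; linarith
  have hqf : IsQFSystem fun n => weightedExp w hwm hwG (lam n) := by
    refine isQFSystem_weightedExp hwm hwG hwne hstep hND hk (c := c) (fun j => ?_) fun j x => ?_
    · refine (hcq j).trans (div_le_self (by positivity) ?_)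
      nlinarith [Nat.cast_nonneg (α := ℝ) j]
    · rw [hΔ, abs_of_nonneg (hw0 x)]
      exact hwΔ j x
  obtain ⟨g, hg, hgt, G, hG, hgG⟩ := exists_entire_translates w hwm hw0 hwG
  refine ⟨lam, g, hg, ⟨1, one_pos, fun m n hmn => ?_⟩, hpos, fun n => ?_, ?_, ?_, G, hG, hgG⟩
  · refine le_trans ?_ (abs_natCast_sub_le_of_one_le_step hstep n m)
    have : 1 ≤ |(m : ℤ) - n| := Int.one_le_abs (by omega)
    exact_mod_cast this
  · rw [gt_iff_lt, lt_div_iff₀ (hpos n)]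
    exact hratio n
  · simp_rw [hgt]
    exact hqf.map (Lp.fourierTransformₗᵢ ℝ ℂ)
  · rw [show g = fun t : ℝ => G t from funext hgG]
    exact (hG.contDiff.restrict_scalars ℝ).comp Complex.ofRealCLM.contDiff

theorem proposition1 :
    (∃ (lam : ℕ → ℝ) (g : ℝ → ℂ) (hg : MemLp g 2 volume),
      UniformlyDiscrete lam ∧
      IsQFSystem (fun n => translateLp g hg (lam n)) ∧
      ContDiff ℝ ∞ g ∧
      ∃ G : ℂ → ℂ, Differentiable ℂ G ∧ ∀ t : ℝ, g t = G (t : ℂ)) ∧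
    (∀ ε : ℕ → ℝ, (∀ n, 0 < ε n) → Tendsto ε atTop (𝓝 0) →
      ∃ (lam : ℕ → ℝ) (g : ℝ → ℂ) (hg : MemLp g 2 volume),
        UniformlyDiscrete lam ∧
        (∀ n, 0 < lam n) ∧
        (∀ n, lam (n + 1) / lam n > 1 + ε n) ∧
        IsQFSystem (fun n => translateLp g hg (lam n)) ∧
        ContDiff ℝ ∞ g ∧
        ∃ G : ℂ → ℂ, Differentiable ℂ G ∧ ∀ t : ℝ, g t = G (t : ℂ)) := by
  refine ⟨?_, fun ε hε hε0 => exists_quasiLacunary_qfSystem hε hε0⟩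
  -- Any positive null sequence would do here.
  obtain ⟨lam, g, hg, h1, -, -, h4, h5, h6⟩ := exists_quasiLacunary_qfSystem
    (ε := fun n => 1 / ((n : ℝ) + 1)) (fun n => by positivity)
    tendsto_one_div_add_atTop_nhds_zero_nat
  exact ⟨lam, g, hg, h1, h4, h5, h6⟩
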